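/- Let $\omega:[0,\infty)\to[0,\infty)$ be a non-quasianalytic subadditive weight function, i.e. a continuous increasing (non-decreasing) function such that $\omega(s+t)\le\omega(s)+\omega(t)$ for $s,t\ge 0$; $\int_1^\infty \omega(t)t^{-2}\,dt<\infty$; there are $A\in\mathbb R$, $B>0$ with $\omega(t)\ge A+B\log(1+t)$ for $t\ge 0$; and $t\mapsto\omega(e^t)$ is convex on $\mathbb R$. For a vector $z$ write $\omega(z)=\omega(|z|)$ with the Euclidean norm, and let $m_\lambda(z)=e^{\lambda\omega(z)}$. Let $\mathcal S_\omega(\mathbb R^d)$ be the space of all $u\in L^1(\mathbb R^d)$ with $u,\hat u\in C^\infty(\mathbb R^d)$ and $\sup_x e^{\mu\omega(x)}|D^\alpha u(x)|<\infty$, $\sup_\xi e^{\mu\omega(\xi)}|D^\alpha\hat u(\xi)|<\infty$ for all $\mu>0$, $\alpha\in\mathbb N_0^d$, where $\hat u(\xi)=\int u(x)e^{-ix\cdot\xi}\,dx$, with the topology given by these suprema as seminorms, and let $\mathcal S'_\omega(\mathbb R^d)$ be its dual space. For $f\in\mathcal S'_\omega(\mathbb R^d)$ and $g\in\mathcal S_\omega(\mathbb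 R^d)$ let $V_gf(x,\xi)=\langle f,M_\xi T_xg\rangle$, where $M_\xi T_xg(y)=e^{iy\cdot\xi}g(y-x)$ and $\langle\cdot,\cdot\rangle$ extends the inner product of $L^2$ (conjugate-linear in the second argument), so that formally $V_gf(x,\xi)=\int f(y)\overline{g(y-x)}e^{-iy\cdot\xi}\,dy$. For $H\in\mathcal S_\omega(\mathbb R^d)$ let $f*H\in\mathcal S'_\omega(\mathbb R^d)$ be the convolution, $(f*H)(u)=f\bigl(y\mapsto\int H(x-y)u(x)\,dx\bigr)$ for $u\in\mathcal S_\omega(\mathbb R^d)$. For $\lambda\ge 0$ and windows $\varphi,g\in\mathcal S_\omega(\mathbb R^d)\setminus\{0\}$ (the spaces below do not depend on the choice of the window) let $$\mathbf M^\infty_{m_\lambda}(\mathbb R^d)=\{f\in\mathcal S'_\omega(\mathbb R^d):\ V_\varphi f\,m_\lambda\in L^\infty(\mathbb R^{2d})\},$$ $$\mathbf M^{\infty,1}_{m_\lambda}(\mathbb R^d)=\Bigl\{f\in\mathcal S'_\omega(\mathbb R^d):\ \int_{\mathbb R^d}\sup_{x\in\mathbb R^d}|V_gf(x,\xi)|e^{\lambda\omega(x,\xi)}\,d\xi<\infty\Bigr\},$$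 $$\mathbf M^{0,1}_{m_\lambda}(\mathbb R^d)=\Bigl\{f\in\mathbf M^{\infty,1}_{m_\lambda}(\mathbb R^d):\ \lim_{|x|\to\infty}e^{\lambda\omega(x)}\int_{\mathbb R^d}|V_gf(x,\xi)|e^{\lambda\omega(\xi)}\,d\xi=0\Bigr\}.$$ **Lemma.** Let $\lambda\ge 0$, $g_0\in\mathcal S_\omega(\mathbb R^d)\setminus\{0\}$ and $a\in\mathbf M^\infty_{m_\lambda}(\mathbb R^d)$ (with respect to some window $\varphi\in\mathcal S_\omega(\mathbb R^d)\setminus\{0\}$) be such that $$\lim_{|x|\to\infty}\ \sup_{|\xi|\le R}|V_{g_0}a(x,\xi)|\,e^{\lambda\omega(x,\xi)}=0\qquad\text{for all }R>0.$$ Then $a*H\in\mathbf M^{0,1}_{m_\lambda}(\mathbb R^d)$ (with respect to every window $g\in\mathcal S_\omega(\mathbb R^d)\setminus\{0\}$) for every $H\in\mathcal S_\omega(\mathbb R^d)$. -/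

import Mathlib

open MeasureTheory Filter Topology
open scoped ENNReal NNReal

noncomputable section

namespace OmegaTempered

/-- A non-quasianalytic subadditive weight function `ω : [0, ∞) → [0, ∞)`
(the values of `toFun` on negative numbers are irrelevant). -/
structure WeightFunction where
  toFun : ℝ → ℝ
  continuousOn : ContinuousOn toFun (Set.Ici 0)
  monotoneOn : MonotoneOn toFun (Set.Ici 0)
  nonneg : ∀ t, 0 ≤ t → 0 ≤ toFun t
  subadditive : ∀ s t, 0 ≤ s → 0 ≤ t → toFun (s + t) ≤ toFun s + toFun t
  nonquasianalytic : IntegrableOn (fun t => toFun t / t ^ 2) (Set.Ioi 1)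
  log_le : ∃ A B : ℝ, 0 < B ∧ ∀ t, 0 ≤ t → A + B * Real.log (1 + t) ≤ toFun t
  convex_exp : ConvexOn ℝ Set.univ (fun t => toFun (Real.exp t))

instance : CoeFun WeightFunction (fun _ => ℝ → ℝ) := ⟨WeightFunction.toFun⟩

/-- `ℝ^d` with its Euclidean norm. -/
abbrev Euc (d : ℕ) : Type := EuclideanSpace ℝ (Fin d)

variable {d : ℕ} (ω : WeightFunction)

/-- `û(ξ) = ∫ e^{-i x·ξ} u(x) dx`. -/
def fourier (u : Euc d → ℂ) (ξ : Euc d) : ℂ :=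
  ∫ x, Complex.exp (-(Complex.I * ((inner ℝ x ξ : ℝ) : ℂ))) * u x

/-- `sup_x e^{l ω(|x|)} |D^α u(x)| < ∞` for all `l > 0` and all multi-indices `α`: the norm of the
`n`-th Fréchet derivative is comparable to the maximum of the `|D^α u(x)|` with `|α| = n`. -/
def RapidDecay (u : Euc d → ℂ) : Prop :=
  ∀ l : ℝ, 0 < l → ∀ n : ℕ,
    BddAbove (Set.range fun x => Real.exp (l * ω ‖x‖) * ‖iteratedFDeriv ℝ n u x‖)

/-- Membership in the space `S_ω(ℝ^d)`. -/
structure MemS (u : Euc d → ℂ) : Prop where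
  integrable : Integrable u
  contDiff : ContDiff ℝ (⊤ : ℕ∞) u
  contDiff_fourier : ContDiff ℝ (⊤ : ℕ∞) (fourier u)
  decay : RapidDecay ω u
  decay_fourier : RapidDecay ω (fourier u)

section Facts

variable {ω}

lemma norm_char (x ξ : Euc d) :
    ‖Complex.exp (-(Complex.I * ((inner ℝ x ξ : ℝ) : ℂ)))‖ = 1 := by
  rw [Complex.norm_exp]; simp

lemma contDiff_char (ξ : Euc d) :
    ContDiff ℝ (⊤ : ℕ∞) fun x : Euc d => Complex.exp (-(Complex.I * ((inner ℝ x ξ : ℝ) : ℂ))) := by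
  have h : ContDiff ℝ (⊤ : ℕ∞) fun x : Euc d => ((inner ℝ x ξ : ℝ) : ℂ) :=
    Complex.ofRealCLM.contDiff.comp (contDiff_id.inner ℝ contDiff_const)
  exact (contDiff_const.mul h).neg.cexp

lemma integrable_char {u : Euc d → ℂ} (hu : Integrable u) (ξ : Euc d) :
    Integrable fun x => Complex.exp (-(Complex.I * ((inner ℝ x ξ : ℝ) : ℂ))) * u x :=
  hu.bdd_mul (c := 1) (contDiff_char ξ).continuous.aestronglyMeasurable
    (Eventually.of_forall fun x => (norm_char x ξ).le)

lemma norm_iteratedFDeriv_char (ξ : Euc d) (n : ℕ) (x : Euc d) :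
    ‖iteratedFDeriv ℝ n
      (fun x : Euc d => Complex.exp (-(Complex.I * ((inner ℝ x ξ : ℝ) : ℂ)))) x‖ ≤ ‖ξ‖ ^ n := by
  induction n with
  | zero => simp [norm_char]
  | succ n ih =>
    rw [← norm_iteratedFDeriv_fderiv]
    set e : Euc d → ℂ := fun x => Complex.exp (-(Complex.I * ((inner ℝ x ξ : ℝ) : ℂ))) with he
    let L : Euc d →L[ℝ] ℂ := -(Complex.I • (Complex.ofRealCLM.comp (innerSL ℝ ξ)))
    have hL : ‖L‖ ≤ ‖ξ‖ := by
      refine ContinuousLinearMap.opNorm_le_bound _ (norm_nonneg _) fun y => ?_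
      simpa [L] using abs_real_inner_le_norm ξ y
    have hd : fderiv ℝ e = fun y => (ContinuousLinearMap.lsmul ℝ ℂ).flip L (e y) := by
      funext y
      have h1 : HasFDerivAt (fun x : Euc d => L x) L y := L.hasFDerivAt
      have h2 := h1.cexp
      have h3 : (fun x : Euc d => Complex.exp (L x)) = e := by
        funext z; simp [he, L, real_inner_comm]
      rw [h3] at h2
      rw [h2.fderiv]
      have h4 : Complex.exp (L y) = e y := congrFun h3 y
      rw [h4]
      ext z; simp
    rw [hd]
    refine (ContinuousLinearMap.norm_iteratedFDeriv_comp_left _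
      ((contDiff_char ξ).contDiffAt.of_le (by exact_mod_cast le_top)) le_rfl).trans ?_
    rw [pow_succ']
    refine mul_le_mul (le_trans ?_ hL) ih (norm_nonneg _) (norm_nonneg _)
    refine ContinuousLinearMap.opNorm_le_bound _ (norm_nonneg _) fun y => ?_
    simp [norm_smul, mul_comm]

lemma weight_sub_le (x a : Euc d) : ω ‖x‖ ≤ ω ‖x - a‖ + ω ‖a‖ := by
  refine le_trans (ω.monotoneOn (norm_nonneg _) ?_ ?_)
    (ω.subadditive _ _ (norm_nonneg _) (norm_nonneg _))
  · exact add_nonneg (norm_nonneg _) (norm_nonneg _)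
  · simpa using norm_add_le (x - a) a

lemma RapidDecay.exists_bound {u : Euc d → ℂ} (hu : RapidDecay ω u) {l : ℝ} (hl : 0 < l)
    (n : ℕ) :
    ∃ C, 0 ≤ C ∧ ∀ x, Real.exp (l * ω ‖x‖) * ‖iteratedFDeriv ℝ n u x‖ ≤ C := by
  obtain ⟨C, hC⟩ := hu l hl n
  have h := fun x => hC (Set.mem_range_self x)
  exact ⟨C, le_trans (by positivity) (h 0), h⟩

lemma RapidDecay.of_bound {u : Euc d → ℂ}
    (h : ∀ l : ℝ, 0 < l → ∀ n : ℕ,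
      ∃ C, ∀ x, Real.exp (l * ω ‖x‖) * ‖iteratedFDeriv ℝ n u x‖ ≤ C) : RapidDecay ω u := by
  intro l hl n
  obtain ⟨C, hC⟩ := h l hl n
  exact ⟨C, by rintro _ ⟨x, rfl⟩; exact hC x⟩

lemma RapidDecay.of_norm_eq {u v : Euc d → ℂ} (hu : RapidDecay ω u) {f : Euc d → Euc d}
    (hf : ∀ x, ‖f x‖ = ‖x‖)
    (h : ∀ n x, ‖iteratedFDeriv ℝ n v x‖ = ‖iteratedFDeriv ℝ n u (f x)‖) : RapidDecay ω v := by
  refine .of_bound fun l hl n => ?_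
  obtain ⟨C, -, hC⟩ := hu.exists_bound hl n
  exact ⟨C, fun x => by rw [h, ← hf x]; exact hC _⟩

lemma le_contDiff {u : Euc d → ℂ} (hu : ContDiff ℝ (⊤ : ℕ∞) u) (n : ℕ) : ContDiff ℝ n u :=
  hu.of_le (by exact_mod_cast le_top)

lemma RapidDecay.add {u v : Euc d → ℂ} (hu : RapidDecay ω u) (hv : RapidDecay ω v)
    (cu : ContDiff ℝ (⊤ : ℕ∞) u) (cv : ContDiff ℝ (⊤ : ℕ∞) v) : RapidDecay ω (u + v) := by
  refine .of_bound fun l hl n => ?_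
  obtain ⟨C, -, hC⟩ := hu.exists_bound hl n
  obtain ⟨D, -, hD⟩ := hv.exists_bound hl n
  refine ⟨C + D, fun x => ?_⟩
  rw [iteratedFDeriv_add_apply (le_contDiff cu n).contDiffAt (le_contDiff cv n).contDiffAt]
  calc _ ≤ Real.exp (l * ω ‖x‖) * (‖iteratedFDeriv ℝ n u x‖ + ‖iteratedFDeriv ℝ n v x‖) := by
        gcongr; exact norm_add_le _ _
    _ ≤ _ := by rw [mul_add]; exact add_le_add (hC x) (hD x)

lemma RapidDecay.const_smul {u : Euc d → ℂ} (hu : RapidDecay ω u)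
    (cu : ContDiff ℝ (⊤ : ℕ∞) u) (c : ℂ) : RapidDecay ω (c • u) := by
  refine .of_bound fun l hl n => ?_
  obtain ⟨C, -, hC⟩ := hu.exists_bound hl n
  refine ⟨‖c‖ * C, fun x => ?_⟩
  rw [iteratedFDeriv_const_smul_apply (le_contDiff cu n).contDiffAt, norm_smul]
  calc _ = ‖c‖ * (Real.exp (l * ω ‖x‖) * ‖iteratedFDeriv ℝ n u x‖) := by ring
    _ ≤ _ := by gcongr; exact hC x

lemma RapidDecay.zero : RapidDecay ω (0 : Euc d → ℂ) := by
  refine .of_bound fun l hl n => ⟨0, fun x => ?_⟩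
  have : iteratedFDeriv ℝ n (0 : Euc d → ℂ) = 0 := iteratedFDeriv_fun_zero
  simp [this]

/-- The Leibniz estimate: a product of a rapidly decaying function with a smooth one, all of
whose derivatives are bounded. -/
lemma mul_bound {u v : Euc d → ℂ} (cu : ContDiff ℝ (⊤ : ℕ∞) u) (cv : ContDiff ℝ (⊤ : ℕ∞) v)
    {b c : ℕ → ℝ} (hu : ∀ n x, ‖iteratedFDeriv ℝ n u x‖ ≤ b n) {l : ℝ}
    (hv : ∀ n x, Real.exp (l * ω ‖x‖) * ‖iteratedFDeriv ℝ n v x‖ ≤ c n) (n : ℕ) (x : Euc d) :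
    Real.exp (l * ω ‖x‖) * ‖iteratedFDeriv ℝ n (fun y => u y * v y) x‖ ≤
      ∑ i ∈ Finset.range (n + 1), (n.choose i : ℝ) * b i * c (n - i) := by
  have h := norm_iteratedFDeriv_mul_le (n := n) cu cv x (by exact_mod_cast le_top)
  calc _ ≤ Real.exp (l * ω ‖x‖) * _ := mul_le_mul_of_nonneg_left h (Real.exp_nonneg _)
    _ ≤ _ := by
        rw [Finset.mul_sum]
        refine Finset.sum_le_sum fun i _ => ?_
        have hb : 0 ≤ b i := (norm_nonneg _).trans (hu i x)
        calc _ = (n.choose i : ℝ) * ‖iteratedFDeriv ℝ i u x‖ *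
              (Real.exp (l * ω ‖x‖) * ‖iteratedFDeriv ℝ (n - i) v x‖) := by ring
          _ ≤ _ := by
              gcongr
              · exact hu i x
              · exact hv _ x

lemma RapidDecay.mul_char {u : Euc d → ℂ} (hu : RapidDecay ω u)
    (cu : ContDiff ℝ (⊤ : ℕ∞) u) (ξ : Euc d) :
    RapidDecay ω fun x => Complex.exp (-(Complex.I * ((inner ℝ x ξ : ℝ) : ℂ))) * u x := by
  refine .of_bound fun l hl n => ?_
  choose c _ hc using fun n => hu.exists_bound hl n
  exact ⟨_, mul_bound (contDiff_char ξ) cu (norm_iteratedFDeriv_char ξ) hc n⟩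

lemma RapidDecay.translate {u : Euc d → ℂ} (hu : RapidDecay ω u) (a : Euc d) :
    RapidDecay ω fun x => u (x - a) := by
  refine .of_bound fun l hl n => ?_
  obtain ⟨C, hC0, hC⟩ := hu.exists_bound hl n
  refine ⟨Real.exp (l * ω ‖a‖) * C, fun x => ?_⟩
  rw [iteratedFDeriv_comp_sub]
  calc _ ≤ Real.exp (l * ω ‖a‖ + l * ω ‖x - a‖) * ‖iteratedFDeriv ℝ n u (x - a)‖ := by
        gcongr
        have := mul_le_mul_of_nonneg_left (weight_sub_le (ω := ω) x a) hl.le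
        linarith
    _ ≤ _ := by
        rw [Real.exp_add, mul_assoc]
        exact mul_le_mul_of_nonneg_left (hC _) (Real.exp_nonneg _)

lemma RapidDecay.conj {u : Euc d → ℂ} (hu : RapidDecay ω u) :
    RapidDecay ω fun x => starRingEnd ℂ (u x) :=
  hu.of_norm_eq (f := id) (fun _ => rfl) fun n x =>
    LinearIsometryEquiv.norm_iteratedFDeriv_comp_left Complex.conjLIE u x n

lemma RapidDecay.neg_arg {u : Euc d → ℂ} (hu : RapidDecay ω u) :
    RapidDecay ω fun x => u (-x) :=
  hu.of_norm_eq (f := fun x => -x) (fun x => norm_neg x) fun n x =>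
    LinearIsometryEquiv.norm_iteratedFDeriv_comp_right (LinearIsometryEquiv.neg ℝ) u x n

lemma contDiff_conj {u : Euc d → ℂ} (hu : ContDiff ℝ (⊤ : ℕ∞) u) :
    ContDiff ℝ (⊤ : ℕ∞) fun x => starRingEnd ℂ (u x) :=
  Complex.conjCLE.contDiff.comp hu

lemma fourier_conj (u : Euc d → ℂ) :
    fourier (fun x => starRingEnd ℂ (u x)) = fun ξ => starRingEnd ℂ (fourier u (-ξ)) := by
  funext ξ
  simp only [fourier]
  rw [← integral_conj]
  refine integral_congr_ae (Eventually.of_forall fun x => ?_)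
  simp [← Complex.exp_conj]

lemma fourier_translate (u : Euc d → ℂ) (a : Euc d) :
    fourier (fun x => u (x - a)) =
      fun ξ => Complex.exp (-(Complex.I * ((inner ℝ ξ a : ℝ) : ℂ))) * fourier u ξ := by
  funext ξ
  simp only [fourier]
  rw [← integral_add_right_eq_self _ a, ← integral_const_mul]
  refine integral_congr_ae (Eventually.of_forall fun x => ?_)
  simp only [add_sub_cancel_right, inner_add_left, ← mul_assoc, ← Complex.exp_add]
  rw [real_inner_comm a ξ]
  congr 2
  push_cast; ring

lemma fourier_mul_char (u : Euc d → ℂ) (a : Euc d) :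
    fourier (fun x => Complex.exp (-(Complex.I * ((inner ℝ x a : ℝ) : ℂ))) * u x) =
      fun ξ => fourier u (ξ - (-a)) := by
  funext ξ
  simp only [fourier]
  refine integral_congr_ae (Eventually.of_forall fun x => ?_)
  simp only [sub_neg_eq_add, inner_add_right, ← mul_assoc, ← Complex.exp_add]
  congr 2
  push_cast; ring

end Facts

/-- `S_ω(ℝ^d)` as a vector space of functions. -/
def SSubmodule (d : ℕ) : Submodule ℂ (Euc d → ℂ) where
  carrier := {u | MemS ω u}
  zero_mem' := by
    have h : fourier (0 : Euc d → ℂ) = 0 := by funext ξ; simp [fourier]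
    exact ⟨integrable_zero _ _ _, contDiff_const, by rw [h]; exact contDiff_const,
      .zero, by rw [h]; exact .zero⟩
  add_mem' := by
    intro u v hu hv
    have h : fourier (u + v) = fourier u + fourier v := by
      funext ξ
      simp only [fourier, Pi.add_apply, mul_add]
      exact integral_add (integrable_char hu.integrable ξ) (integrable_char hv.integrable ξ)
    exact ⟨hu.integrable.add hv.integrable, hu.contDiff.add hv.contDiff,
      by rw [h]; exact hu.contDiff_fourier.add hv.contDiff_fourier,
      hu.decay.add hv.decay hu.contDiff hv.contDiff,
      by rw [h]; exact hu.decay_fourier.add hv.decay_fourier hu.contDiff_fourier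
          hv.contDiff_fourier⟩
  smul_mem' := by
    intro c u hu
    have h : fourier (c • u) = c • fourier u := by
      funext ξ
      simp only [fourier, Pi.smul_apply, smul_eq_mul, ← integral_const_mul]
      exact integral_congr_ae (Eventually.of_forall fun x => by ring)
    exact ⟨hu.integrable.smul c, contDiff_const.smul hu.contDiff,
      by rw [h]; exact contDiff_const.smul hu.contDiff_fourier,
      hu.decay.const_smul hu.contDiff c,
      by rw [h]; exact hu.decay_fourier.const_smul hu.contDiff_fourier c⟩

/-- The space `S_ω(ℝ^d)`. It does not carry the topology of pointwise convergence. -/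
def S (d : ℕ) : Type := SSubmodule ω d

instance : AddCommGroup (S ω d) := inferInstanceAs (AddCommGroup (SSubmodule ω d))
instance : Module ℂ (S ω d) := inferInstanceAs (Module ℂ (SSubmodule ω d))

namespace S

variable {ω}

/-- The function underlying an element of `S_ω(ℝ^d)`. -/
def val (u : S ω d) : Euc d → ℂ := Subtype.val u

lemma memS (u : S ω d) : MemS ω u.val := Subtype.property u

/-- The element of `S_ω(ℝ^d)` given by a function. -/
def mk (u : Euc d → ℂ) (hu : MemS ω u) : S ω d := ⟨u, hu⟩

lemma ext {u v : S ω d} (h : u.val = v.val) : u = v := Subtype.ext h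

lemma val_mk (u : Euc d → ℂ) (hu : MemS ω u) : (mk u hu).val = u := rfl
lemma val_add (u v : S ω d) : (u + v).val = u.val + v.val := rfl
lemma val_smul (c : ℂ) (u : S ω d) : (c • u).val = c • u.val := rfl

lemma fourier_add (u v : S ω d) :
    fourier (u + v).val = fourier u.val + fourier v.val := by
  funext ξ
  simp only [fourier, val_add, Pi.add_apply, mul_add]
  exact integral_add (integrable_char u.memS.integrable ξ) (integrable_char v.memS.integrable ξ)

lemma fourier_smul (c : ℂ) (u : S ω d) :
    fourier (c • u).val = c • fourier u.val := by
  funext ξ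
  simp only [fourier, val_smul, Pi.smul_apply, smul_eq_mul, ← integral_const_mul]
  exact integral_congr_ae (Eventually.of_forall fun x => by ring)

/-- The seminorm `sup_x e^{l ω(x)} ‖D^n (T u)(x)‖` for a linear map `T` into functions. -/
def decaySeminorm (T : S ω d → Euc d → ℂ) (hadd : ∀ u v, T (u + v) = T u + T v)
    (hsmul : ∀ (c : ℂ) u, T (c • u) = c • T u) (hc : ∀ u, ContDiff ℝ (⊤ : ℕ∞) (T u))
    (hd : ∀ u, RapidDecay ω (T u)) (l : Set.Ioi (0 : ℝ)) (n : ℕ) : Seminorm ℂ (S ω d) :=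
  Seminorm.of
    (fun u => ⨆ x, Real.exp (l * ω ‖x‖) * ‖iteratedFDeriv ℝ n (T u) x‖)
    (by
      intro u v
      refine ciSup_le fun x => ?_
      rw [hadd, iteratedFDeriv_add_apply (le_contDiff (hc u) n).contDiffAt
        (le_contDiff (hc v) n).contDiffAt]
      refine le_trans (mul_le_mul_of_nonneg_left (norm_add_le _ _) (Real.exp_nonneg _)) ?_
      rw [mul_add]
      exact add_le_add (le_ciSup (hd u l l.2 n) x) (le_ciSup (hd v l l.2 n) x))
    (by
      intro c u
      rw [Real.mul_iSup_of_nonneg (norm_nonneg c)]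
      congr 1
      funext x
      rw [hsmul, iteratedFDeriv_const_smul_apply (le_contDiff (hc u) n).contDiffAt, norm_smul]
      ring)

/-- The seminorm `sup_x e^{l ω(x)} ‖D^n u(x)‖`. -/
def seminorm (l : Set.Ioi (0 : ℝ)) (n : ℕ) : Seminorm ℂ (S ω d) :=
  decaySeminorm val val_add val_smul (fun u => u.memS.contDiff) (fun u => u.memS.decay) l n

/-- The seminorm `sup_ξ e^{l ω(ξ)} ‖D^n û(ξ)‖`. -/
def seminormFourier (l : Set.Ioi (0 : ℝ)) (n : ℕ) : Seminorm ℂ (S ω d) :=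
  decaySeminorm (fun u => fourier u.val) fourier_add fourier_smul
    (fun u => u.memS.contDiff_fourier) (fun u => u.memS.decay_fourier) l n

lemma seminorm_apply (l : Set.Ioi (0 : ℝ)) (n : ℕ) (u : S ω d) :
    seminorm l n u = ⨆ x, Real.exp (l * ω ‖x‖) * ‖iteratedFDeriv ℝ n u.val x‖ := rfl

lemma seminormFourier_apply (l : Set.Ioi (0 : ℝ)) (n : ℕ) (u : S ω d) :
    seminormFourier l n u =
      ⨆ ξ, Real.exp (l * ω ‖ξ‖) * ‖iteratedFDeriv ℝ n (fourier u.val) ξ‖ := rfl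

/-- The seminorms that define the Fréchet space topology of `S_ω(ℝ^d)`. -/
def seminormFamily (ω : WeightFunction) (d : ℕ) :
    SeminormFamily ℂ (S ω d) ((Set.Ioi (0 : ℝ) × ℕ) ⊕ (Set.Ioi (0 : ℝ) × ℕ)) :=
  Sum.elim (fun i => seminorm i.1 i.2) (fun i => seminormFourier i.1 i.2)

instance : TopologicalSpace (S ω d) := (seminormFamily ω d).moduleFilterBasis.topology

lemma withSeminorms (ω : WeightFunction) (d : ℕ) : WithSeminorms (seminormFamily ω d) := ⟨rfl⟩

instance : IsTopologicalAddGroup (S ω d) := (withSeminorms ω d).topologicalAddGroup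
instance : ContinuousSMul ℂ (S ω d) := (withSeminorms ω d).continuousSMul

/-- Complex conjugation on `S_ω(ℝ^d)`. -/
def conj (u : S ω d) : S ω d :=
  mk (fun x => starRingEnd ℂ (u.val x))
    { integrable := Complex.conjLIE.toContinuousLinearEquiv.toContinuousLinearMap.integrable_comp
        u.memS.integrable
      contDiff := contDiff_conj u.memS.contDiff
      contDiff_fourier := by
        rw [fourier_conj]; exact contDiff_conj (u.memS.contDiff_fourier.comp contDiff_neg)
      decay := u.memS.decay.conj
      decay_fourier := by rw [fourier_conj]; exact u.memS.decay_fourier.neg_arg.conj }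

/-- The translation `T_a u(y) = u(y - a)`. -/
def translate (a : Euc d) (u : S ω d) : S ω d :=
  mk (fun y => u.val (y - a))
    { integrable := u.memS.integrable.comp_sub_right a
      contDiff := u.memS.contDiff.comp (contDiff_id.sub contDiff_const)
      contDiff_fourier := by
        rw [fourier_translate]; exact (contDiff_char a).mul u.memS.contDiff_fourier
      decay := u.memS.decay.translate a
      decay_fourier := by
        rw [fourier_translate]; exact u.memS.decay_fourier.mul_char u.memS.contDiff_fourier a }

lemma memS_mul_char (u : S ω d) (ξ : Euc d) :
    MemS ω fun x => Complex.exp (-(Complex.I * ((inner ℝ x ξ : ℝ) : ℂ))) * u.val x where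
  integrable := integrable_char u.memS.integrable ξ
  contDiff := (contDiff_char ξ).mul u.memS.contDiff
  contDiff_fourier := by
    rw [fourier_mul_char]; exact u.memS.contDiff_fourier.comp (contDiff_id.sub contDiff_const)
  decay := u.memS.decay.mul_char u.memS.contDiff ξ
  decay_fourier := by rw [fourier_mul_char]; exact u.memS.decay_fourier.translate _

/-- The modulation `M_ξ u(y) = e^{i y·ξ} u(y)`. -/
def modulate (ξ : Euc d) (u : S ω d) : S ω d :=
  mk (fun y => Complex.exp (Complex.I * ((inner ℝ y ξ : ℝ) : ℂ)) * u.val y)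
    (by simpa using memS_mul_char u (-ξ))

section Correlation

lemma contDiff_integral (n : ℕ) {F : Type} [NormedAddCommGroup F] [NormedSpace ℝ F]
    [CompleteSpace F] {f : Euc d → Euc d → F}
    (hf : ContDiff ℝ (⊤ : ℕ∞) (Function.uncurry f))
    (hb : ∀ k : ℕ, ∃ b : Euc d → ℝ, Integrable b ∧ ∀ s y, ‖iteratedFDeriv ℝ k (f s) y‖ ≤ b s) :
    ContDiff ℝ n (fun y => ∫ s, f s y) ∧
      ∀ y, ‖iteratedFDeriv ℝ n (fun y => ∫ s, f s y) y‖ ≤ ∫ s, ‖iteratedFDeriv ℝ n (f s) y‖ := by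
  induction n generalizing F with
  | zero =>
    obtain ⟨b, hbi, hb⟩ := hb 0
    refine ⟨?_, fun y => ?_⟩
    · refine contDiff_zero.2 (continuous_of_dominated (bound := b) (fun y => ?_)
        (fun y => Eventually.of_forall fun s => by simpa using hb s y) hbi
        (Eventually.of_forall fun s => ?_))
      · exact (hf.continuous.comp (by fun_prop : Continuous fun s : Euc d => (s, y))
          ).aestronglyMeasurable
      · exact hf.continuous.comp (by fun_prop : Continuous fun y : Euc d => (s, y))
    · simpa using norm_integral_le_integral_norm (fun s => f s y)
  | succ n ih =>
    obtain ⟨b0, hb0i, hb0⟩ := hb 0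
    obtain ⟨b1, hb1i, hb1⟩ := hb 1
    have hf' : ContDiff ℝ (⊤ : ℕ∞) (Function.uncurry fun s y => fderiv ℝ (f s) y) := by
      have : ContDiff ℝ (⊤ : ℕ∞) (Function.uncurry fun (p : Euc d × Euc d) y => f p.1 y) :=
        hf.comp ((contDiff_fst.comp contDiff_fst).prodMk contDiff_snd)
      exact ContDiff.fderiv (f := fun (p : Euc d × Euc d) y => f p.1 y) this contDiff_snd
        (by simp)
    have hfs : ∀ s, ContDiff ℝ (⊤ : ℕ∞) (f s) := fun s =>
      hf.comp (contDiff_const.prodMk contDiff_id)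
    have hd : ∀ y, HasFDerivAt (fun y => ∫ s, f s y) (∫ s, fderiv ℝ (f s) y) y := fun y => by
      have hm : ∀ y, AEStronglyMeasurable (fun s => f s y) := fun y =>
        (hf.continuous.comp (by fun_prop : Continuous fun s : Euc d => (s, y))
          ).aestronglyMeasurable
      refine hasFDerivAt_integral_of_dominated_of_fderiv_le (F := fun y s => f s y)
        (F' := fun y s => fderiv ℝ (f s) y) (bound := b1) (s := Set.univ) univ_mem
        (Eventually.of_forall hm) ?_ ?_ ?_ hb1i ?_
      · exact hb0i.mono' (hm y) (Eventually.of_forall fun s => by simpa using hb0 s y)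
      · exact (hf'.continuous.comp (by fun_prop : Continuous fun s : Euc d => (s, y))
          ).aestronglyMeasurable
      · refine Eventually.of_forall fun s y _ => ?_
        have := hb1 s y
        rwa [← norm_iteratedFDeriv_fderiv, norm_iteratedFDeriv_zero] at this
      · exact Eventually.of_forall fun s y _ =>
          ((hfs s).differentiable (by simp)).differentiableAt.hasFDerivAt
    have hfd : fderiv ℝ (fun y => ∫ s, f s y) = fun y => ∫ s, fderiv ℝ (f s) y :=
      funext fun y => (hd y).fderiv
    obtain ⟨h1, h2⟩ := ih hf' fun k => by
      obtain ⟨b, hbi, hb⟩ := hb (k + 1)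
      exact ⟨b, hbi, fun s y => by
        have := hb s y
        rwa [← norm_iteratedFDeriv_fderiv] at this⟩
    refine ⟨?_, fun y => ?_⟩
    · push_cast
      refine contDiff_succ_iff_fderiv.2 ⟨fun y => (hd y).differentiableAt, by simp, ?_⟩
      rw [hfd]; exact h1
    · rw [← norm_iteratedFDeriv_fderiv, hfd]
      simpa only [← norm_iteratedFDeriv_fderiv (𝕜 := ℝ) (n := n)] using h2 y

lemma continuous_weight : Continuous fun x : Euc d => ω ‖x‖ :=
  ω.continuousOn.comp_continuous continuous_norm fun x => norm_nonneg x

lemma integrable_exp_weight :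
    ∃ l : ℝ, 0 < l ∧ Integrable fun x : Euc d => Real.exp (-(l * ω ‖x‖)) := by
  obtain ⟨A, B, hB, h⟩ := ω.log_le
  set r : ℝ := d + 1 with hr
  have hr0 : 0 < r := by positivity
  refine ⟨r / B, by positivity, ?_⟩
  have hi : Integrable fun x : Euc d => (1 + ‖x‖) ^ (-r) :=
    integrable_one_add_norm (by simp [hr])
  refine (hi.const_mul (Real.exp (-(r / B * A)))).mono'
    (Real.continuous_exp.comp (continuous_const.mul continuous_weight).neg).aestronglyMeasurable
    (Eventually.of_forall fun x => ?_)
  have hx : 0 < 1 + ‖x‖ := by positivity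
  rw [Real.norm_eq_abs, Real.abs_exp, Real.rpow_def_of_pos hx, ← Real.exp_add]
  refine Real.exp_le_exp.2 ?_
  have h1 := mul_le_mul_of_nonneg_left (h ‖x‖ (norm_nonneg x)) (by positivity : 0 ≤ r / B)
  have h2 : r / B * (A + B * Real.log (1 + ‖x‖)) = r / B * A + Real.log (1 + ‖x‖) * r := by
    field_simp
  linarith

lemma integrable_weight_mul (H : S ω d) {l : ℝ} (hl : 0 < l) :
    Integrable fun x => Real.exp (l * ω ‖x‖) * ‖H.val x‖ := by
  obtain ⟨m, hm, hi⟩ := integrable_exp_weight (ω := ω) (d := d)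
  obtain ⟨C, -, hC⟩ := H.memS.decay.exists_bound (add_pos hl hm) 0
  refine (hi.const_mul C).mono'
    ((Real.continuous_exp.comp (continuous_const.mul continuous_weight)).mul
      H.memS.contDiff.continuous.norm).aestronglyMeasurable (Eventually.of_forall fun x => ?_)
  have h := hC x
  rw [norm_iteratedFDeriv_zero] at h
  rw [Real.norm_eq_abs, abs_of_nonneg (by positivity)]
  calc _ = Real.exp ((l + m) * ω ‖x‖) * ‖H.val x‖ * Real.exp (-(m * ω ‖x‖)) := by
        rw [mul_right_comm, ← Real.exp_add]; congr 2; ring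
    _ ≤ _ := mul_le_mul_of_nonneg_right h (Real.exp_nonneg _)

/-- The function `y ↦ ∫ H(x - y) u(x) dx`. -/
def correlationFun (H u : S ω d) (y : Euc d) : ℂ := ∫ x, H.val (x - y) * u.val x

lemma correlationFun_eq (H u : S ω d) :
    correlationFun H u = fun y => ∫ s, H.val s * u.val (y + s) := by
  funext y
  rw [correlationFun, ← integral_add_right_eq_self _ y]
  simp only [add_sub_cancel_right]
  simp only [add_comm y]

lemma iteratedFDeriv_mul_shift (H u : S ω d) (n : ℕ) (s y : Euc d) :
    ‖iteratedFDeriv ℝ n (fun y => H.val s * u.val (y + s)) y‖ =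
      ‖H.val s‖ * ‖iteratedFDeriv ℝ n u.val (y + s)‖ := by
  have : (fun y => H.val s * u.val (y + s)) = H.val s • fun y => u.val (y + s) := rfl
  have hc : ContDiff ℝ n fun y => u.val (y + s) :=
    (le_contDiff u.memS.contDiff n).comp (contDiff_id.add contDiff_const)
  rw [this, iteratedFDeriv_const_smul_apply hc.contDiffAt, norm_smul, iteratedFDeriv_comp_add_right]

lemma correlationFun_contDiff (H u : S ω d) (n : ℕ) :
    ContDiff ℝ n (correlationFun H u) ∧ ∀ y, ‖iteratedFDeriv ℝ n (correlationFun H u) y‖ ≤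
      ∫ s, ‖H.val s‖ * ‖iteratedFDeriv ℝ n u.val (y + s)‖ := by
  rw [correlationFun_eq]
  have h := contDiff_integral n (f := fun s y => H.val s * u.val (y + s))
    ((H.memS.contDiff.comp contDiff_fst).mul
      (u.memS.contDiff.comp (contDiff_snd.add contDiff_fst))) (fun k => by
      obtain ⟨C, -, hC⟩ := u.memS.decay.exists_bound one_pos k
      refine ⟨_, H.memS.integrable.norm.mul_const C, fun s y => ?_⟩
      rw [iteratedFDeriv_mul_shift]
      refine mul_le_mul_of_nonneg_left (le_trans ?_ (hC (y + s))) (norm_nonneg _)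
      exact le_mul_of_one_le_left (norm_nonneg _) (Real.one_le_exp
        (by have := ω.nonneg _ (norm_nonneg (y + s)); linarith)))
  simpa only [iteratedFDeriv_mul_shift] using h

lemma correlationFun_bound (H u : S ω d) {l : ℝ} (hl : 0 < l) (n : ℕ) {C : ℝ}
    (hC : ∀ x, Real.exp (l * ω ‖x‖) * ‖iteratedFDeriv ℝ n u.val x‖ ≤ C) (y : Euc d) :
    Real.exp (l * ω ‖y‖) * ‖iteratedFDeriv ℝ n (correlationFun H u) y‖ ≤
      (∫ s, Real.exp (l * ω ‖s‖) * ‖H.val s‖) * C := by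
  refine (mul_le_mul_of_nonneg_left ((correlationFun_contDiff H u n).2 y)
    (Real.exp_nonneg _)).trans ?_
  rw [← integral_const_mul, ← integral_mul_const]
  refine integral_mono_of_nonneg (Eventually.of_forall fun s => by positivity)
    ((integrable_weight_mul H hl).mul_const C) (Eventually.of_forall fun s => ?_)
  have hw : ω ‖y‖ ≤ ω ‖s‖ + ω ‖y + s‖ := by
    have := weight_sub_le (ω := ω) y (-s)
    simpa [add_comm] using this
  have he : Real.exp (l * ω ‖y‖) ≤ Real.exp (l * ω ‖s‖) * Real.exp (l * ω ‖y + s‖) := by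
    rw [← Real.exp_add, ← mul_add]
    exact Real.exp_le_exp.2 (mul_le_mul_of_nonneg_left hw hl.le)
  calc _ ≤ Real.exp (l * ω ‖s‖) * Real.exp (l * ω ‖y + s‖) *
        (‖H.val s‖ * ‖iteratedFDeriv ℝ n u.val (y + s)‖) :=
        mul_le_mul_of_nonneg_right he (by positivity)
    _ = Real.exp (l * ω ‖s‖) * ‖H.val s‖ *
        (Real.exp (l * ω ‖y + s‖) * ‖iteratedFDeriv ℝ n u.val (y + s)‖) := by ring
    _ ≤ _ := mul_le_mul_of_nonneg_left (hC _) (by positivity)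

lemma integrable_correlation_prod (H u : S ω d) :
    Integrable (fun p : Euc d × Euc d => H.val p.2 * u.val (p.1 + p.2))
      (volume.prod volume) := by
  have h1 := H.memS.contDiff.continuous
  have h2 := u.memS.contDiff.continuous
  refine (integrable_prod_iff' (by fun_prop)).2 ⟨Eventually.of_forall fun s => ?_, ?_⟩
  · exact (u.memS.integrable.comp_add_right s).const_mul (H.val s)
  · simp only [norm_mul, integral_const_mul]
    have : ∀ s, ∫ y, ‖u.val (y + s)‖ = ∫ y, ‖u.val y‖ := fun s =>
      integral_add_right_eq_self (fun y => ‖u.val y‖) s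
    simp only [this]
    exact H.memS.integrable.norm.mul_const _

lemma fourier_correlationFun (H u : S ω d) :
    fourier (correlationFun H u) = fun ξ => fourier H.val (-ξ) * fourier u.val ξ := by
  funext ξ
  rw [correlationFun_eq]
  have hint : Integrable (fun p : Euc d × Euc d =>
      Complex.exp (-(Complex.I * ((inner ℝ p.1 ξ : ℝ) : ℂ))) * (H.val p.2 * u.val (p.1 + p.2)))
      (volume.prod volume) :=
    (integrable_correlation_prod H u).bdd_mul (c := 1)
      ((contDiff_char ξ).continuous.comp continuous_fst).aestronglyMeasurable
      (Eventually.of_forall fun p => (norm_char p.1 ξ).le)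
  simp only [fourier]
  rw [← integral_mul_const]
  simp only [← integral_const_mul (Complex.exp _)]
  rw [integral_integral_swap hint]
  refine integral_congr_ae (Eventually.of_forall fun s => ?_)
  simp only
  rw [← integral_add_right_eq_self (fun y => Complex.exp (-(Complex.I * _)) * u.val y) s,
    ← integral_const_mul]
  refine integral_congr_ae (Eventually.of_forall fun y => ?_)
  simp only [inner_add_left, inner_neg_right]
  have : Complex.exp (-(Complex.I * ((inner ℝ y ξ : ℝ) : ℂ))) =
      Complex.exp (-(Complex.I * ((-inner ℝ s ξ : ℝ) : ℂ))) *
        Complex.exp (-(Complex.I * ((inner ℝ y ξ + inner ℝ s ξ : ℝ) : ℂ))) := by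
    rw [← Complex.exp_add]; congr 1; push_cast; ring
  rw [this]; ring

lemma fourier_correlationFun_bound (H : S ω d) (n : ℕ) :
    ∃ b : ℕ → ℝ, (∀ i, 0 ≤ b i) ∧ ∀ (u : S ω d) (l : ℝ) (c : ℕ → ℝ),
      (∀ k ξ, Real.exp (l * ω ‖ξ‖) * ‖iteratedFDeriv ℝ k (fourier u.val) ξ‖ ≤ c k) →
      ∀ ξ, Real.exp (l * ω ‖ξ‖) * ‖iteratedFDeriv ℝ n (fourier (correlationFun H u)) ξ‖ ≤
        ∑ i ∈ Finset.range (n + 1), (n.choose i : ℝ) * b i * c (n - i) := by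
  have hd : RapidDecay ω fun ξ => fourier H.val (-ξ) := H.memS.decay_fourier.neg_arg
  choose b hb0 hb using fun k => hd.exists_bound one_pos k
  refine ⟨b, hb0, fun u l c hc ξ => ?_⟩
  rw [fourier_correlationFun]
  refine mul_bound (H.memS.contDiff_fourier.comp contDiff_neg) u.memS.contDiff_fourier
    (fun k x => le_trans ?_ (hb k x)) hc n ξ
  exact le_mul_of_one_le_left (norm_nonneg _) (Real.one_le_exp
    (by have := ω.nonneg _ (norm_nonneg x); linarith))

lemma memS_correlationFun (H u : S ω d) : MemS ω (correlationFun H u) where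
  integrable := by rw [correlationFun_eq]; exact (integrable_correlation_prod H u).integral_prod_left
  contDiff := contDiff_infty.2 fun n => (correlationFun_contDiff H u n).1
  contDiff_fourier := by
    rw [fourier_correlationFun]
    exact (H.memS.contDiff_fourier.comp contDiff_neg).mul u.memS.contDiff_fourier
  decay := .of_bound fun l hl n => by
    obtain ⟨C, -, hC⟩ := u.memS.decay.exists_bound hl n
    exact ⟨_, correlationFun_bound H u hl n hC⟩
  decay_fourier := .of_bound fun l hl n => by
    obtain ⟨b, -, hb⟩ := fourier_correlationFun_bound H n
    choose c _ hc using fun k => u.memS.decay_fourier.exists_bound hl k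
    exact ⟨_, hb u l c hc⟩

/-- The function `y ↦ ∫ H(x - y) u(x) dx` as an element of `S_ω(ℝ^d)`, linear in `u`. -/
def correlationLinear (H : S ω d) : S ω d →ₗ[ℂ] S ω d where
  toFun u := mk (correlationFun H u) (memS_correlationFun H u)
  map_add' u v := by
    apply ext
    have hi : ∀ (w : S ω d) y, Integrable fun x => H.val (x - y) * w.val x := fun w y =>
      by
        obtain ⟨C, -, hC⟩ := H.memS.decay.exists_bound one_pos 0
        refine w.memS.integrable.bdd_mul (c := C)
          (H.memS.contDiff.continuous.comp (continuous_sub_right y)).aestronglyMeasurable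
          (Eventually.of_forall fun x => le_trans ?_ (hC (x - y)))
        rw [norm_iteratedFDeriv_zero]
        exact le_mul_of_one_le_left (norm_nonneg _) (Real.one_le_exp
          (by have := ω.nonneg _ (norm_nonneg (x - y)); linarith))
    funext y
    simp only [val_mk, val_add, Pi.add_apply, correlationFun, mul_add]
    exact integral_add (hi u y) (hi v y)
  map_smul' c u := by
    apply ext
    funext y
    simp only [val_mk, val_smul, Pi.smul_apply, correlationFun, smul_eq_mul, RingHom.id_apply,
      ← integral_const_mul]
    exact integral_congr_ae (Eventually.of_forall fun x => by ring)

lemma le_seminorm (u : S ω d) (l : Set.Ioi (0 : ℝ)) (n : ℕ) (x : Euc d) :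
    Real.exp (l * ω ‖x‖) * ‖iteratedFDeriv ℝ n u.val x‖ ≤ seminorm l n u :=
  le_ciSup (u.memS.decay l l.2 n) x

lemma le_seminormFourier (u : S ω d) (l : Set.Ioi (0 : ℝ)) (n : ℕ) (ξ : Euc d) :
    Real.exp (l * ω ‖ξ‖) * ‖iteratedFDeriv ℝ n (fourier u.val) ξ‖ ≤ seminormFourier l n u :=
  le_ciSup (u.memS.decay_fourier l l.2 n) ξ

lemma continuous_seminorm (l : Set.Ioi (0 : ℝ)) (n : ℕ) :
    Continuous (seminorm l n : Seminorm ℂ (S ω d)) :=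
  (withSeminorms ω d).continuous_seminorm (Sum.inl (l, n))

lemma continuous_seminormFourier (l : Set.Ioi (0 : ℝ)) (n : ℕ) :
    Continuous (seminormFourier l n : Seminorm ℂ (S ω d)) :=
  (withSeminorms ω d).continuous_seminorm (Sum.inr (l, n))

lemma continuous_correlationLinear (H : S ω d) : Continuous (correlationLinear H) := by
  have key : ∀ (q : Seminorm ℂ (S ω d)) (p : S ω d → ℝ), Continuous p → p 0 = 0 →
      (∀ u, q u ≤ p u) → Continuous q := by
    intro q p hp hp0 hqp
    refine Seminorm.continuous_of_forall fun r hr => ?_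
    have : ∀ᶠ u in 𝓝 (0 : S ω d), p u < r :=
      hp.continuousAt.eventually_lt_const (by rwa [hp0])
    filter_upwards [this] with u hu
    rw [Seminorm.mem_ball_zero]
    exact (hqp u).trans_lt hu
  refine ((withSeminorms ω d).continuous_iff_continuous_comp (correlationLinear H)).2 ?_
  rintro (⟨l, n⟩ | ⟨l, n⟩)
  · refine key _ (fun u => (∫ s, Real.exp (l * ω ‖s‖) * ‖H.val s‖) * seminorm l n u)
      (continuous_const.mul (continuous_seminorm l n)) (by simp) fun u => ?_
    exact ciSup_le fun y => correlationFun_bound H u l.2 n (le_seminorm u l n) y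
  · obtain ⟨b, -, hb⟩ := fourier_correlationFun_bound H n
    refine key _ (fun u => ∑ i ∈ Finset.range (n + 1),
        (n.choose i : ℝ) * b i * seminormFourier l (n - i) u)
      (continuous_finsetSum _ fun i _ => continuous_const.mul (continuous_seminormFourier l _))
      (by simp) fun u => ?_
    exact ciSup_le fun ξ => hb u l (fun k => seminormFourier l k u)
      (fun k => le_seminormFourier u l k) ξ

/-- The continuous linear map `u ↦ (y ↦ ∫ H(x - y) u(x) dx)` of `S_ω(ℝ^d)`, that is, the convolution
with the reflection of `H`. -/
def correlation (H : S ω d) : S ω d →L[ℂ] S ω d :=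
  ⟨correlationLinear H, continuous_correlationLinear H⟩

end Correlation

end S

/-- The space `S'_ω(ℝ^d)` of `ω`-tempered distributions: continuous linear functionals. -/
abbrev Dist (d : ℕ) : Type := S ω d →L[ℂ] ℂ

variable {ω}

/-- The convolution `a * H` of `a ∈ S'_ω(ℝ^d)` and `H ∈ S_ω(ℝ^d)`, defined by duality:
`(a * H)(u) = a(y ↦ ∫ H(x - y) u(x) dx)`. -/
def convolution (a : Dist ω d) (H : S ω d) : Dist ω d := a.comp H.correlation

/-- The short-time Fourier transform `V_g f(x, ξ) = ⟨f, M_ξ T_x g⟩`, where `⟨·, ·⟩` extends the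
inner product of `L²`, conjugate-linear in the second argument. -/
def stft (g : S ω d) (f : Dist ω d) (x ξ : Euc d) : ℂ :=
  f (S.conj (S.modulate ξ (S.translate x g)))

variable (ω)

/-- The weight `m_l(x, ξ) = e^{l ω(|(x, ξ)|)}` on `ℝ^{2d}`. -/
def weight (l : ℝ) (x ξ : Euc d) : ℝ :=
  Real.exp (l * ω (Real.sqrt (‖x‖ ^ 2 + ‖ξ‖ ^ 2)))

/-- The weight `m_l(x) = e^{l ω(|x|)}` on `ℝ^d`. -/
def weightOne (l : ℝ) (x : Euc d) : ℝ := Real.exp (l * ω ‖x‖)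

/-- `F ∈ L^{p,q}_{m_l}(ℝ^{2d})`: the `L^p` norm in `x`, then the `L^q` norm in `ξ`. -/
def MemMixedLp (l : ℝ) (p q : ℝ≥0∞) (F : Euc d → Euc d → ℂ) : Prop :=
  AEStronglyMeasurable (Function.uncurry F) (volume.prod volume) ∧
    eLpNorm (fun ξ => eLpNorm (fun x => F x ξ * (weight ω l x ξ : ℂ)) p volume) q volume < ∞

variable {ω}

/-- The modulation space `M^{p,q}_{m_l}(ℝ^d)`, described through the nonzero window `φ`. -/
def modulationSpace (l : ℝ) (p q : ℝ≥0∞) (φ : S ω d) : Set (Dist ω d) :=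
  {f | MemMixedLp ω l p q (stft φ f)}

/-- The space `M^{0,1}_{m_l}(ℝ^d)`, described through the nonzero window `g`: the `f` in
`M^{∞,1}_{m_l}(ℝ^d)` for which `‖V_g f(x, ·)‖_{L^1_{m_l}(ℝ^d)} e^{l ω(x)} → 0` as `|x| → ∞`. -/
def modulationSpaceZeroOne (l : ℝ) (g : S ω d) : Set (Dist ω d) :=
  {f | f ∈ modulationSpace l ∞ 1 g ∧
    Tendsto (fun x => (∫⁻ ξ, ‖stft g f x ξ‖ₑ * ENNReal.ofReal (weightOne ω l ξ)) *
      ENNReal.ofReal (weightOne ω l x)) (cocompact (Euc d)) (𝓝 0)}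

end OmegaTempered

end

/-! The short-time Fourier transform of `a * H` is that of `a` itself, taken with a window that
moves with the frequency: V_g(a * H)(x, ξ) = V_{G_ξ} a(x, ξ), where G_ξ is `convolutionWindow H g ξ`
(`stft_convolution`). Since |Ĝ_ξ(η)| = |Ĥ(η + ξ)| |ĝ(η)|, the Fourier transform of G_ξ is small of
every order e^{-kω(ξ)}, while G_ξ decays in time uniformly in ξ. Together these make V_φ G_ξ decay
in both of its variables and in ξ (`exists_stftFun_convolutionWindow_le`).

The second ingredient is the change of window `weightedStft_le_lintegral`: the weighted |V_ψ a| is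
at most a constant times an average of translates of the weighted |V_γ a|, with the integrable
kernel given by V_γ ψ. For γ = φ and ψ = G_ξ it bounds |V_g(a * H)| m_l by C e^{-kω(ξ)}, uniformly
in x and for every k, which gives membership in M^{∞,1}. For γ = g₀ and ψ = G_ξ with ξ fixed,
dominated convergence carries the vanishing of V_{g₀} a over to V_{G_ξ} a (`tendsto_weightedStft`).
A second dominated convergence, in ξ, with the bound C e^{-kω(ξ)}, gives the limit that defines
M^{0,1}.

The change of window rests on the inversion formula for the short-time Fourier transform, and `a`
has to be pulled through that integral. For this, the derivative-free norms sup e^{lω}|u| + sup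
e^{lω}|û| are shown to control all the seminorms of S_ω
(`exp_weight_mul_iteratedFDeriv_le_of_decay`). By Hahn–Banach, `a` then comes from a functional on a
Banach space of pairs of bounded continuous functions (`Dist.exists_factorization`), and there the
inversion formula is a Bochner integral. -/

noncomputable section

namespace OmegaTempered

variable {d : ℕ} {ω : WeightFunction}

/-! ### Elementary properties of the weights e^{lω}. -/

section Weights

lemma weight_nonneg (x : Euc d) : 0 ≤ ω ‖x‖ := ω.nonneg _ (norm_nonneg x)

lemma one_le_exp_weight {l : ℝ} (hl : 0 ≤ l) (x : Euc d) : 1 ≤ Real.exp (l * ω ‖x‖) :=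
  Real.one_le_exp (mul_nonneg hl (weight_nonneg x))

lemma exp_weight_mono {l m : ℝ} (h : l ≤ m) (x : Euc d) :
    Real.exp (l * ω ‖x‖) ≤ Real.exp (m * ω ‖x‖) :=
  Real.exp_le_exp.2 (mul_le_mul_of_nonneg_right h (weight_nonneg x))

lemma exp_weight_add_le {l : ℝ} (hl : 0 ≤ l) (x y : Euc d) :
    Real.exp (l * ω ‖x + y‖) ≤ Real.exp (l * ω ‖x‖) * Real.exp (l * ω ‖y‖) := by
  rw [← Real.exp_add, ← mul_add]
  have := weight_sub_le (ω := ω) (x + y) y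
  rw [add_sub_cancel_right] at this
  exact Real.exp_le_exp.2 (mul_le_mul_of_nonneg_left this hl)

lemma continuous_exp_weight (l : ℝ) : Continuous fun x : Euc d => Real.exp (l * ω ‖x‖) :=
  Real.continuous_exp.comp (continuous_const.mul S.continuous_weight)

/-- Exponentiating ω(t) ≥ A + B log(1 + t), multiplied by r / B: powers of e^ω absorb every
polynomial. -/
lemma one_add_norm_rpow_le (r : ℝ) (hr : 0 < r) :
    ∃ m C : ℝ, 0 < m ∧ 0 ≤ C ∧ ∀ x : Euc d, (1 + ‖x‖) ^ r ≤ C * Real.exp (m * ω ‖x‖) := by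
  obtain ⟨A, B, hB, h⟩ := ω.log_le
  refine ⟨r / B, Real.exp (-(r / B * A)), by positivity, (Real.exp_pos _).le, fun x => ?_⟩
  have hx : 0 < 1 + ‖x‖ := by positivity
  rw [Real.rpow_def_of_pos hx, ← Real.exp_add]
  refine Real.exp_le_exp.2 ?_
  have h1 := mul_le_mul_of_nonneg_left (h ‖x‖ (norm_nonneg x)) (by positivity : 0 ≤ r / B)
  have h2 : r / B * (A + B * Real.log (1 + ‖x‖)) = r / B * A + Real.log (1 + ‖x‖) * r := by
    field_simp
  linarith

lemma exists_norm_le_exp_weight :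
    ∃ m C : ℝ, 0 < m ∧ 0 ≤ C ∧ ∀ x : Euc d, ‖x‖ ≤ C * Real.exp (m * ω ‖x‖) := by
  obtain ⟨m, C, hm, hC, h⟩ := one_add_norm_rpow_le (d := d) (ω := ω) 1 one_pos
  refine ⟨m, C, hm, hC, fun x => le_trans ?_ (h x)⟩
  rw [Real.rpow_one]; linarith

/-- Each factor ‖x‖ costs a fixed multiple p of ω in the exponent, so k * p is added to an exponent
that is already integrable. -/
lemma integrable_pow_mul_exp_weight (k : ℕ) :
    ∃ m : ℝ, 0 < m ∧ ∀ l, m ≤ l →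
      Integrable fun x : Euc d => ‖x‖ ^ k * Real.exp (-(l * ω ‖x‖)) := by
  obtain ⟨m, hm, hi⟩ := S.integrable_exp_weight (ω := ω) (d := d)
  obtain ⟨p, C, hp, hC, h⟩ := exists_norm_le_exp_weight (d := d) (ω := ω)
  refine ⟨k * p + m, by positivity, fun l hl => ?_⟩
  refine (hi.const_mul (C ^ k)).mono' ((continuous_norm.pow k).mul
    (Real.continuous_exp.comp (continuous_const.mul S.continuous_weight).neg)).aestronglyMeasurable
    (Eventually.of_forall fun x => ?_)
  rw [Real.norm_of_nonneg (by positivity)]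
  calc ‖x‖ ^ k * Real.exp (-(l * ω ‖x‖))
      ≤ (C * Real.exp (p * ω ‖x‖)) ^ k * Real.exp (-((k * p + m) * ω ‖x‖)) := by
        gcongr
        · exact h x
        · exact weight_nonneg x
    _ = C ^ k * Real.exp (-(m * ω ‖x‖)) := by
        rw [mul_pow, ← Real.exp_nat_mul, mul_assoc, ← Real.exp_add]; congr 2; ring

lemma exists_integrable_exp_weight :
    ∃ m : ℝ, 0 < m ∧ ∀ l, m ≤ l → Integrable fun x : Euc d => Real.exp (-(l * ω ‖x‖)) := by
  simpa using integrable_pow_mul_exp_weight (d := d) (ω := ω) 0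

end Weights

/-! ### Fourier inversion in the normalization e^{-ix·ξ}. -/

section Inversion

open scoped FourierTransform

lemma fourier_eq_fourierTransform (f : Euc d → ℂ) (ξ : Euc d) :
    fourier f ξ = 𝓕 f ((2 * Real.pi)⁻¹ • ξ) := by
  rw [Real.fourier_eq', fourier]
  refine integral_congr_ae (Eventually.of_forall fun x => ?_)
  simp only [inner_smul_right, smul_eq_mul]
  congr 2
  have : -2 * Real.pi * ((2 * Real.pi)⁻¹ * inner ℝ x ξ) = - inner ℝ x ξ := by
    field_simp
  rw [this]; push_cast; ring

/-- The constant `(2π)^{-d}` of the Fourier inversion formula. -/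
def inversionConst (d : ℕ) : ℝ := |((2 * Real.pi) ^ Module.finrank ℝ (Euc d))⁻¹|

lemma inversionConst_pos : 0 < inversionConst d := by unfold inversionConst; positivity

lemma fourier_inversion {f : Euc d → ℂ} (hc : Continuous f) (hf : Integrable f)
    (hf' : Integrable (fourier f)) (y : Euc d) :
    f y = inversionConst d * fourier (fourier f) (-y) := by
  have h2 : (2 * Real.pi) ≠ 0 := by positivity
  have h𝓕 : 𝓕 f = fun ξ => fourier f ((2 * Real.pi) • ξ) := by
    funext ξ; rw [fourier_eq_fourierTransform, smul_smul, inv_mul_cancel₀ h2, one_smul]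
  have hi : Integrable (𝓕 f) := by rw [h𝓕]; exact hf'.comp_smul h2
  have h := hf.fourierInv_fourier_eq hi (v := y) hc.continuousAt
  rw [← h, Real.fourierInv_eq', h𝓕]
  -- The substitution ξ ↦ 2πξ; its Jacobian is `inversionConst d`.
  have := Measure.integral_comp_smul volume
    (fun ξ : Euc d => Complex.exp (-(Complex.I * ((inner ℝ ξ (-y) : ℝ) : ℂ))) * fourier f ξ)
    (2 * Real.pi)
  rw [inversionConst, fourier, ← Complex.real_smul, ← this]
  refine integral_congr_ae (Eventually.of_forall fun ξ => ?_)
  simp only [inner_smul_left, inner_neg_right, smul_eq_mul]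
  congr 2
  simp; ring

namespace S

lemma integrable_fourier (u : S ω d) : Integrable (fourier u.val) := by
  obtain ⟨m, hm, hi⟩ := S.integrable_exp_weight (ω := ω) (d := d)
  obtain ⟨C, -, hC⟩ := u.memS.decay_fourier.exists_bound hm 0
  refine (hi.const_mul C).mono' u.memS.contDiff_fourier.continuous.aestronglyMeasurable
    (Eventually.of_forall fun x => ?_)
  have h := hC x
  rw [norm_iteratedFDeriv_zero] at h
  calc ‖fourier u.val x‖ =
        Real.exp (m * ω ‖x‖) * ‖fourier u.val x‖ * Real.exp (-(m * ω ‖x‖)) := by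
        rw [mul_right_comm, ← Real.exp_add]; simp
    _ ≤ _ := mul_le_mul_of_nonneg_right h (Real.exp_nonneg _)

lemma inversion (u : S ω d) (y : Euc d) :
    u.val y = inversionConst d * fourier (fourier u.val) (-y) :=
  fourier_inversion u.memS.contDiff.continuous u.memS.integrable u.integrable_fourier y

/-- This is what makes S_ω invariant under the Fourier transform, so that every estimate for u also
applies to û. -/
lemma fourier_fourier (u : S ω d) :
    fourier (fourier u.val) = (((inversionConst d)⁻¹ : ℝ) : ℂ) • fun y => u.val (-y) := by
  funext y
  have : (inversionConst d : ℂ) ≠ 0 := by exact_mod_cast inversionConst_pos.ne'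
  simp only [Pi.smul_apply, smul_eq_mul, inversion u (-y), neg_neg]
  push_cast
  rw [inv_mul_cancel_left₀ this]

/-- The Fourier transform as a map of `S_ω(ℝ^d)`. -/
def fourierS (u : S ω d) : S ω d :=
  mk (fourier u.val)
    { integrable := u.integrable_fourier
      contDiff := u.memS.contDiff_fourier
      contDiff_fourier := by
        rw [fourier_fourier]
        exact contDiff_const.smul (u.memS.contDiff.comp contDiff_neg)
      decay := u.memS.decay_fourier
      decay_fourier := by
        rw [fourier_fourier]
        exact u.memS.decay.neg_arg.const_smul (u.memS.contDiff.comp contDiff_neg) _ }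

end S

end Inversion

/-! ### Weighted derivative bounds by interpolation. -/

section DerivativeBounds

/-- The Landau inequality with weights. -/
lemma exp_weight_mul_fderiv_le {F : Type} [NormedAddCommGroup F] [NormedSpace ℝ F]
    {f : Euc d → F} (hf : ContDiff ℝ (⊤ : ℕ∞) f) {l K : ℝ} (hl : 0 ≤ l)
    (h0 : ∀ x, Real.exp (2 * l * ω ‖x‖) * ‖f x‖ ≤ K)
    (h2 : ∀ x, ‖iteratedFDeriv ℝ 2 f x‖ ≤ K) (x : Euc d) :
    Real.exp (l * ω ‖x‖) * ‖fderiv ℝ f x‖ ≤ (2 + Real.exp (2 * l * ω 1)) * K := by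
  have hK : 0 ≤ K := (norm_nonneg _).trans (h2 x)
  have hdf : ContDiff ℝ (⊤ : ℕ∞) (fderiv ℝ f) := hf.fderiv_right (by simp)
  have hlip : ∀ z, ‖fderiv ℝ f z - fderiv ℝ f x‖ ≤ K * ‖z - x‖ := fun z =>
    Convex.norm_image_sub_le_of_norm_fderiv_le (𝕜 := ℝ) (s := Set.univ)
      (fun z _ => (hdf.differentiable (by simp)).differentiableAt)
      (fun z _ => by
        have := h2 z
        rwa [← norm_iteratedFDeriv_fderiv, ← norm_iteratedFDeriv_fderiv,
          norm_iteratedFDeriv_zero] at this) convex_univ trivial trivial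
  set E := Real.exp (l * ω ‖x‖) with hE
  have hE0 : 0 < E := Real.exp_pos _
  have hE1 : 1 ≤ E := one_le_exp_weight hl x
  have hEE : Real.exp (2 * l * ω ‖x‖) = E * E := by
    rw [hE, ← Real.exp_add]; congr 1; ring
  have hfx : E * E * ‖f x‖ ≤ K := hEE ▸ h0 x
  -- The step length e^{-lω(x)} balances the two sides of Taylor's formula: the quadratic remainder
  -- and the values of `f` at x and x + v are all of order ‖v‖².
  have hmain : ∀ v : Euc d, ‖v‖ = E⁻¹ →
      E * ‖fderiv ℝ f x v‖ ≤ (2 + Real.exp (2 * l * ω 1)) * K * ‖v‖ := fun v hv => by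
    have hv1 : ‖v‖ ≤ 1 := by rw [hv]; exact inv_le_one_of_one_le₀ hE1
    have hT : ‖f (x + v) - f x - fderiv ℝ f x v‖ ≤ K * ‖v‖ * ‖v‖ := by
      have := Convex.norm_image_sub_le_of_norm_fderiv_le' (𝕜 := ℝ) (f := f)
        (s := Metric.closedBall x ‖v‖) (x := x) (y := x + v) (C := K * ‖v‖) (φ := fderiv ℝ f x)
        (fun z _ => (hf.differentiable (by simp)).differentiableAt)
        (fun z hz => (hlip z).trans (mul_le_mul_of_nonneg_left (mem_closedBall_iff_norm.1 hz) hK))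
        (convex_closedBall _ _) (by simp) (by simp)
      simpa using this
    -- Since ‖v‖ ≤ 1, passing from x to x + v costs at most the factor e^{2lω(1)}.
    have hw : E * E ≤ Real.exp (2 * l * ω ‖x + v‖) * Real.exp (2 * l * ω 1) := by
      rw [← hEE]
      have h := exp_weight_add_le (ω := ω) (l := 2 * l) (by positivity) (x + v) (-v)
      rw [add_neg_cancel_right, norm_neg] at h
      refine h.trans ?_
      gcongr
      exact ω.monotoneOn (norm_nonneg v) (zero_le_one' ℝ) hv1
    have hfv : E * E * ‖f (x + v)‖ ≤ Real.exp (2 * l * ω 1) * K :=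
      calc _ ≤ Real.exp (2 * l * ω ‖x + v‖) * Real.exp (2 * l * ω 1) * ‖f (x + v)‖ := by gcongr
        _ = Real.exp (2 * l * ω 1) * (Real.exp (2 * l * ω ‖x + v‖) * ‖f (x + v)‖) := by ring
        _ ≤ _ := by gcongr; exact h0 _
    have htri : ‖fderiv ℝ f x v‖ ≤ K * ‖v‖ * ‖v‖ + ‖f (x + v)‖ + ‖f x‖ := by
      calc _ = ‖f (x + v) - f x - (f (x + v) - f x - fderiv ℝ f x v)‖ := by congr 1; abel
        _ ≤ ‖f (x + v) - f x‖ + ‖f (x + v) - f x - fderiv ℝ f x v‖ := norm_sub_le _ _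
        _ ≤ _ := by linarith [norm_sub_le (f (x + v)) (f x)]
    have hEv : E * ‖v‖ = 1 := by rw [hv]; exact mul_inv_cancel₀ hE0.ne'
    calc E * ‖fderiv ℝ f x v‖ ≤ E * (K * ‖v‖ * ‖v‖ + ‖f (x + v)‖ + ‖f x‖) := by gcongr
      _ = (E * ‖v‖) * (K * ‖v‖) + (E * ‖v‖) * E * (‖f (x + v)‖ + ‖f x‖) := by
          rw [hEv]; linear_combination (K * ‖v‖) * hEv
      _ = K * ‖v‖ + (E * E * ‖f (x + v)‖ + E * E * ‖f x‖) * ‖v‖ := by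
          rw [hEv]; linear_combination (-E * (‖f (x + v)‖ + ‖f x‖)) * hEv
      _ ≤ K * ‖v‖ + (Real.exp (2 * l * ω 1) * K + K) * ‖v‖ := by gcongr
      _ = _ := by ring
  rw [← le_div_iff₀' hE0]
  refine ContinuousLinearMap.opNorm_le_bound _ (by positivity) fun w => ?_
  rcases eq_or_ne w 0 with rfl | hw
  · simp
  have hw0 : 0 < ‖w‖ := norm_pos_iff.2 hw
  have h := hmain ((E⁻¹ * ‖w‖⁻¹) • w) (by
    rw [norm_smul, Real.norm_of_nonneg (by positivity), mul_assoc, inv_mul_cancel₀ hw0.ne', mul_one])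
  rw [map_smul, norm_smul, norm_smul, Real.norm_of_nonneg (by positivity)] at h
  have h' : (E⁻¹ * ‖w‖⁻¹) * (E * ‖fderiv ℝ f x w‖) ≤
      (E⁻¹ * ‖w‖⁻¹) * ((2 + Real.exp (2 * l * ω 1)) * K * ‖w‖) := by linarith
  have h'' := le_of_mul_le_mul_left h' (by positivity)
  rw [div_mul_eq_mul_div, le_div_iff₀' hE0]
  exact h''

/-- Iterated Landau inequality: each derivative doubles the exponent required of `f`, and one
unweighted derivative beyond order n is needed. The target space is quantified inside because the
induction passes from `f` to `fderiv ℝ f`. -/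
lemma exp_weight_mul_iteratedFDeriv_le (n : ℕ) {l : ℝ} (hl : 0 < l) :
    ∃ m C : ℝ, 0 < m ∧ 0 ≤ C ∧ ∀ {F : Type} [NormedAddCommGroup F] [NormedSpace ℝ F]
      {f : Euc d → F}, ContDiff ℝ (⊤ : ℕ∞) f → ∀ K : ℝ,
      (∀ x, Real.exp (m * ω ‖x‖) * ‖f x‖ ≤ K) →
      (∀ k ≤ n + 1, ∀ x, ‖iteratedFDeriv ℝ k f x‖ ≤ K) →
      ∀ x, Real.exp (l * ω ‖x‖) * ‖iteratedFDeriv ℝ n f x‖ ≤ C * K := by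
  induction n with
  | zero =>
    refine ⟨l, 1, hl, zero_le_one, fun {F} _ _ f hf K h _ x => ?_⟩
    simpa using h x
  | succ n ih =>
    obtain ⟨m, C, hm, hC, ih⟩ := ih
    refine ⟨2 * m, C * (2 + Real.exp (2 * m * ω 1)), by positivity, by positivity,
      fun {F} _ _ f hf K h hk x => ?_⟩
    have hK : 0 ≤ K := (norm_nonneg _).trans (hk 0 (by omega) x)
    rw [← norm_iteratedFDeriv_fderiv, mul_assoc]
    refine ih (hf.fderiv_right (by simp)) _
      (exp_weight_mul_fderiv_le hf hm.le h (hk 2 (by omega))) (fun k hkn z => ?_) x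
    rw [norm_iteratedFDeriv_fderiv]
    refine (hk (k + 1) (by omega) z).trans (le_mul_of_one_le_left hK ?_)
    linarith [Real.exp_pos (2 * m * ω 1)]

/-- Derivatives of ĥ fall on the character and produce ‖x‖^k, which the decay of h absorbs. No
derivative of h enters the bound. -/
lemma norm_iteratedFDeriv_fourier_le (k : ℕ) :
    ∃ m C : ℝ, 0 < m ∧ 0 ≤ C ∧ ∀ (h : S ω d) (K : ℝ),
      (∀ x, Real.exp (m * ω ‖x‖) * ‖h.val x‖ ≤ K) →
      ∀ ξ, ‖iteratedFDeriv ℝ k (fourier h.val) ξ‖ ≤ C * K := by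
  obtain ⟨m, hm, hi⟩ := integrable_pow_mul_exp_weight (d := d) (ω := ω) k
  refine ⟨m, ∫ x : Euc d, ‖x‖ ^ k * Real.exp (-(m * ω ‖x‖)), hm,
    integral_nonneg fun x => by positivity, fun h K hK ξ => ?_⟩
  have hnorm : ∀ (j : ℕ) (s y : Euc d), ‖iteratedFDeriv ℝ j (fun y : Euc d =>
      Complex.exp (-(Complex.I * ((inner ℝ s y : ℝ) : ℂ))) * h.val s) y‖ ≤
        ‖s‖ ^ j * ‖h.val s‖ := fun j s y => by
    have he : (fun y : Euc d => Complex.exp (-(Complex.I * ((inner ℝ s y : ℝ) : ℂ))) * h.val s) =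
        h.val s • fun y : Euc d => Complex.exp (-(Complex.I * ((inner ℝ y s : ℝ) : ℂ))) := by
      funext y; simp only [Pi.smul_apply, smul_eq_mul, real_inner_comm s y, mul_comm]
    rw [he, iteratedFDeriv_const_smul_apply (le_contDiff (contDiff_char s) j).contDiffAt,
      norm_smul, mul_comm]
    gcongr
    exact norm_iteratedFDeriv_char s j y
  have hle : ∀ (j : ℕ) (p C : ℝ), (∀ x, Real.exp (p * ω ‖x‖) * ‖h.val x‖ ≤ C) → ∀ s : Euc d,
      ‖s‖ ^ j * ‖h.val s‖ ≤ C * (‖s‖ ^ j * Real.exp (-(p * ω ‖s‖))) := fun j p C hC s =>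
    calc ‖s‖ ^ j * ‖h.val s‖ = (Real.exp (p * ω ‖s‖) * ‖h.val s‖) *
          (‖s‖ ^ j * Real.exp (-(p * ω ‖s‖))) := by
          rw [Real.exp_neg]; field_simp
      _ ≤ _ := mul_le_mul_of_nonneg_right (hC s) (by positivity)
  have hcd := S.contDiff_integral k (f := fun s y : Euc d =>
      Complex.exp (-(Complex.I * ((inner ℝ s y : ℝ) : ℂ))) * h.val s) (by
    have h1 : ContDiff ℝ (⊤ : ℕ∞) fun p : Euc d × Euc d => ((inner ℝ p.1 p.2 : ℝ) : ℂ) :=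
      Complex.ofRealCLM.contDiff.comp (contDiff_fst.inner ℝ contDiff_snd)
    exact ((contDiff_const.mul h1).neg.cexp).mul (h.memS.contDiff.comp contDiff_fst)) (fun j => by
      obtain ⟨p, hp, hj⟩ := integrable_pow_mul_exp_weight (d := d) (ω := ω) j
      obtain ⟨C, -, hC⟩ := h.memS.decay.exists_bound hp 0
      refine ⟨_, (hj p le_rfl).const_mul C, fun s y => (hnorm j s y).trans
        (hle j p C (fun x => by simpa using hC x) s)⟩)
  refine (hcd.2 ξ).trans ?_
  rw [mul_comm, ← integral_const_mul]
  exact integral_mono_of_nonneg (Eventually.of_forall fun s => norm_nonneg _)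
    ((hi m le_rfl).const_mul K)
    (Eventually.of_forall fun s => (hnorm k s ξ).trans (hle k m K hK s))

/-- Lets the preceding bound, applied to û, control the derivatives of u itself. -/
lemma norm_iteratedFDeriv_eq (u : S ω d) (k : ℕ) (y : Euc d) :
    ‖iteratedFDeriv ℝ k u.val y‖ =
      inversionConst d * ‖iteratedFDeriv ℝ k (fourier (fourier u.val)) (-y)‖ := by
  have h : u.val = (inversionConst d : ℂ) • fun y => fourier (fourier u.val) (-y) :=
    funext fun y => u.inversion y
  have hc : ContDiff ℝ (⊤ : ℕ∞) (fourier (fourier u.val)) := u.fourierS.memS.contDiff_fourier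
  have hc' : ContDiff ℝ (⊤ : ℕ∞) fun y => fourier (fourier u.val) (-y) := hc.comp contDiff_neg
  conv_lhs => rw [h]
  rw [iteratedFDeriv_const_smul_apply (le_contDiff hc' k).contDiffAt, norm_smul,
    Complex.norm_of_nonneg inversionConst_pos.le]
  congr 1
  exact LinearIsometryEquiv.norm_iteratedFDeriv_comp_right (LinearIsometryEquiv.neg ℝ)
    (fourier (fourier u.val)) y k

end DerivativeBounds

/-! ### Derivative-free norms and the Banach space factorization of distributions. -/

section Embedding

open scoped BoundedContinuousFunction

/-- Decay of û bounds the derivatives of u without weight, and decay of u bounds those of û;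
interpolating against the decay of the function itself puts the weight back. -/
lemma exp_weight_mul_iteratedFDeriv_le_of_decay (n : ℕ) {l : ℝ} (hl : 0 < l) :
    ∃ m C : ℝ, 0 < m ∧ 0 ≤ C ∧ ∀ (u : S ω d) (K : ℝ),
      (∀ x, Real.exp (m * ω ‖x‖) * ‖u.val x‖ ≤ K) →
      (∀ x, Real.exp (m * ω ‖x‖) * ‖fourier u.val x‖ ≤ K) →
      (∀ x, Real.exp (l * ω ‖x‖) * ‖iteratedFDeriv ℝ n u.val x‖ ≤ C * K) ∧
      (∀ x, Real.exp (l * ω ‖x‖) * ‖iteratedFDeriv ℝ n (fourier u.val) x‖ ≤ C * K) := by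
  obtain ⟨m₀, C₀, hm₀, hC₀, h₀⟩ :=
    exp_weight_mul_iteratedFDeriv_le (d := d) (ω := ω) n hl
  choose m C hm hC h using fun k => norm_iteratedFDeriv_fourier_le (d := d) (ω := ω) k
  have hc := inversionConst_pos (d := d)
  -- Sums dominate each of their terms, so one exponent and one constant serve all orders up to n +
  -- 1, as the interpolation requires.
  set M := m₀ + ∑ k ∈ Finset.range (n + 2), m k with hM
  set D := 1 + (1 + inversionConst d) * ∑ k ∈ Finset.range (n + 2), C k with hD
  have hmM : m₀ ≤ M := le_add_of_nonneg_right (Finset.sum_nonneg fun k _ => (hm k).le)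
  have hkM : ∀ k ≤ n + 1, m k ≤ M := fun k hk =>
    (Finset.single_le_sum (f := m) (fun k _ => (hm k).le)
      (Finset.mem_range.2 (by omega : k < n + 2))).trans (le_add_of_nonneg_left hm₀.le)
  have hS : 0 ≤ ∑ k ∈ Finset.range (n + 2), C k := Finset.sum_nonneg fun k _ => hC k
  have hkD : ∀ k ≤ n + 1, (1 + inversionConst d) * C k ≤ D := fun k hk => by
    have := Finset.single_le_sum (f := C) (fun k _ => hC k)
      (Finset.mem_range.2 (by omega : k < n + 2))
    have := mul_le_mul_of_nonneg_left this (by positivity : 0 ≤ 1 + inversionConst d)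
    linarith
  have hD1 : 1 ≤ D := by
    have : 0 ≤ (1 + inversionConst d) * ∑ k ∈ Finset.range (n + 2), C k := by positivity
    linarith
  refine ⟨M, C₀ * D, by linarith, by positivity, fun u K hu hu' => ?_⟩
  have hK : 0 ≤ K := le_trans (by positivity) (hu 0)
  have hdown : ∀ {p : ℝ} {f : Euc d → ℂ}, p ≤ M →
      (∀ x, Real.exp (M * ω ‖x‖) * ‖f x‖ ≤ K) → ∀ x, Real.exp (p * ω ‖x‖) * ‖f x‖ ≤ K :=
    fun hp hf x => (mul_le_mul_of_nonneg_right (exp_weight_mono hp x) (norm_nonneg _)).trans (hf x)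
  have hKD : K ≤ D * K := le_mul_of_one_le_left hK hD1
  have hkK : ∀ k ≤ n + 1, C k * K ≤ D * K ∧ inversionConst d * (C k * K) ≤ D * K :=
    fun k hk => by
    have h1 := mul_le_mul_of_nonneg_right (hkD k hk) hK
    have h2 : 0 ≤ C k * K := mul_nonneg (hC k) hK
    have h3 : 0 ≤ inversionConst d * (C k * K) := mul_nonneg hc.le h2
    constructor <;> nlinarith
  refine ⟨?_, ?_⟩ <;> rw [mul_assoc]
  · refine h₀ u.memS.contDiff _ (fun x => (hdown hmM hu x).trans hKD) fun k hk x => ?_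
    rw [norm_iteratedFDeriv_eq]
    exact (mul_le_mul_of_nonneg_left (h k u.fourierS K (hdown (hkM k hk) hu') (-x)) hc.le).trans
      (hkK k hk).2
  · exact h₀ u.memS.contDiff_fourier _ (fun x => (hdown hmM hu' x).trans hKD) fun k hk x =>
      (h k u K (hdown (hkM k hk) hu) x).trans (hkK k hk).1

/-- The bounded continuous function `e^{l ω} f`. -/
def weightedBCF (l : Set.Ioi (0 : ℝ)) (f : Euc d → ℂ) (hf : ContDiff ℝ (⊤ : ℕ∞) f)
    (hd : RapidDecay ω f) : Euc d →ᵇ ℂ :=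
  BoundedContinuousFunction.ofNormedAddCommGroup
    (fun x => (Real.exp (l * ω ‖x‖) : ℂ) * f x)
    ((Complex.continuous_ofReal.comp (continuous_exp_weight (ω := ω) l)).mul hf.continuous)
    (hd.exists_bound l.2 0).choose fun x => by
      have h := (hd.exists_bound l.2 0).choose_spec.2 x
      rw [norm_iteratedFDeriv_zero] at h
      rwa [norm_mul, Complex.norm_of_nonneg (Real.exp_pos _).le]

/-- The embedding `u ↦ (e^{l ω} u, e^{l ω} û)` of `S_ω(ℝ^d)` into a Banach space. -/
def embed (l : Set.Ioi (0 : ℝ)) : S ω d →ₗ[ℂ] (Euc d →ᵇ ℂ) × (Euc d →ᵇ ℂ) where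
  toFun u := (weightedBCF l u.val u.memS.contDiff u.memS.decay,
    weightedBCF l (fourier u.val) u.memS.contDiff_fourier u.memS.decay_fourier)
  map_add' u v := by
    refine Prod.ext (BoundedContinuousFunction.ext fun x => ?_)
      (BoundedContinuousFunction.ext fun x => ?_)
    · exact mul_add _ _ _
    · simp [weightedBCF, S.fourier_add, mul_add]
  map_smul' c u := by
    refine Prod.ext (BoundedContinuousFunction.ext fun x => ?_)
      (BoundedContinuousFunction.ext fun x => ?_)
    · exact mul_left_comm _ _ _
    · simp [weightedBCF, S.fourier_smul, mul_left_comm]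

lemma embed_fst_apply (l : Set.Ioi (0 : ℝ)) (u : S ω d) (x : Euc d) :
    (embed l u).1 x = (Real.exp (l * ω ‖x‖) : ℂ) * u.val x := rfl

lemma embed_snd_apply (l : Set.Ioi (0 : ℝ)) (u : S ω d) (x : Euc d) :
    (embed l u).2 x = (Real.exp (l * ω ‖x‖) : ℂ) * fourier u.val x := rfl

lemma norm_exp_weight_mul (l : ℝ) (x : Euc d) (c : ℂ) :
    ‖(Real.exp (l * ω ‖x‖) : ℂ) * c‖ = Real.exp (l * ω ‖x‖) * ‖c‖ := by
  rw [norm_mul, Complex.norm_of_nonneg (Real.exp_pos _).le]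

lemma exp_weight_mul_le_norm_embed (l : Set.Ioi (0 : ℝ)) (u : S ω d) (x : Euc d) :
    Real.exp (l * ω ‖x‖) * ‖u.val x‖ ≤ ‖embed l u‖ := by
  rw [← norm_exp_weight_mul, ← embed_fst_apply]
  exact ((embed l u).1.norm_coe_le_norm x).trans (norm_fst_le _)

lemma exp_weight_mul_fourier_le_norm_embed (l : Set.Ioi (0 : ℝ)) (u : S ω d) (x : Euc d) :
    Real.exp (l * ω ‖x‖) * ‖fourier u.val x‖ ≤ ‖embed l u‖ := by
  rw [← norm_exp_weight_mul, ← embed_snd_apply]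
  exact ((embed l u).2.norm_coe_le_norm x).trans (norm_snd_le _)

lemma norm_embed_le {l : Set.Ioi (0 : ℝ)} {u : S ω d} {K : ℝ}
    (h : ∀ x, Real.exp (l * ω ‖x‖) * ‖u.val x‖ ≤ K)
    (h' : ∀ x, Real.exp (l * ω ‖x‖) * ‖fourier u.val x‖ ≤ K) : ‖embed l u‖ ≤ K := by
  have hK : 0 ≤ K := le_trans (by positivity) (h 0)
  refine norm_prod_le_iff.2 ⟨(BoundedContinuousFunction.norm_le hK).2 fun x => ?_,
    (BoundedContinuousFunction.norm_le hK).2 fun x => ?_⟩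
  · rw [embed_fst_apply, norm_exp_weight_mul]; exact h x
  · rw [embed_snd_apply, norm_exp_weight_mul]; exact h' x

lemma norm_embed_mono {l m : Set.Ioi (0 : ℝ)} (h : l ≤ m) (u : S ω d) :
    ‖embed l u‖ ≤ ‖embed m u‖ :=
  norm_embed_le
    (fun x => (mul_le_mul_of_nonneg_right (exp_weight_mono h x) (norm_nonneg _)).trans
      (exp_weight_mul_le_norm_embed m u x))
    (fun x => (mul_le_mul_of_nonneg_right (exp_weight_mono h x) (norm_nonneg _)).trans
      (exp_weight_mul_fourier_le_norm_embed m u x))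

lemma embed_injective (l : Set.Ioi (0 : ℝ)) : Function.Injective (embed l : S ω d →ₗ[ℂ] _) := by
  refine (injective_iff_map_eq_zero _).2 fun u hu => S.ext (funext fun x => ?_)
  have h := exp_weight_mul_le_norm_embed l u x
  rw [hu, norm_zero] at h
  exact norm_le_zero_iff.1 (nonpos_of_mul_nonpos_right h (Real.exp_pos _))

lemma seminormFamily_le (i : (Set.Ioi (0 : ℝ) × ℕ) ⊕ (Set.Ioi (0 : ℝ) × ℕ)) :
    ∃ (m : Set.Ioi (0 : ℝ)) (C : ℝ), 0 ≤ C ∧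
      ∀ u : S ω d, S.seminormFamily ω d i u ≤ C * ‖embed m u‖ := by
  rcases i with ⟨l, n⟩ | ⟨l, n⟩ <;>
    obtain ⟨m, C, hm, hC, h⟩ := exp_weight_mul_iteratedFDeriv_le_of_decay (d := d) (ω := ω) n l.2
  · exact ⟨⟨m, hm⟩, C, hC, fun u => ciSup_le (h u _
      (exp_weight_mul_le_norm_embed ⟨m, hm⟩ u) (exp_weight_mul_fourier_le_norm_embed ⟨m, hm⟩ u)).1⟩
  · exact ⟨⟨m, hm⟩, C, hC, fun u => ciSup_le (h u _
      (exp_weight_mul_le_norm_embed ⟨m, hm⟩ u) (exp_weight_mul_fourier_le_norm_embed ⟨m, hm⟩ u)).2⟩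

lemma finset_sup_seminormFamily_le (s : Finset ((Set.Ioi (0 : ℝ) × ℕ) ⊕ (Set.Ioi (0 : ℝ) × ℕ))) :
    ∃ (m : Set.Ioi (0 : ℝ)) (C : ℝ), 0 ≤ C ∧
      ∀ u : S ω d, s.sup (S.seminormFamily ω d) u ≤ C * ‖embed m u‖ := by
  classical
  induction s using Finset.induction_on with
  | empty => exact ⟨⟨1, Set.mem_Ioi.2 one_pos⟩, 0, le_rfl, fun u => by simp⟩
  | insert i s _ ih =>
    obtain ⟨m, C, hC, h⟩ := ih
    obtain ⟨m', C', hC', h'⟩ := seminormFamily_le (d := d) (ω := ω) i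
    refine ⟨m ⊔ m', C + C', by positivity, fun u => ?_⟩
    rw [Finset.sup_insert, Seminorm.sup_apply]
    have h1 := (h u).trans (mul_le_mul_of_nonneg_left
      (norm_embed_mono (le_sup_left : m ≤ m ⊔ m') u) hC)
    have h2 := (h' u).trans (mul_le_mul_of_nonneg_left
      (norm_embed_mono (le_sup_right : m' ≤ m ⊔ m') u) hC')
    have h3 : 0 ≤ C * ‖embed (m ⊔ m') u‖ := by positivity
    have h4 : 0 ≤ C' * ‖embed (m ⊔ m') u‖ := by positivity
    rw [add_mul]
    exact max_le (h2.trans (le_add_of_nonneg_left h3)) (h1.trans (le_add_of_nonneg_right h4))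

/-- Every `ω`-tempered distribution factors through one of the embeddings. -/
lemma Dist.exists_factorization (a : Dist ω d) :
    ∃ (l : Set.Ioi (0 : ℝ)) (A : (Euc d →ᵇ ℂ) × (Euc d →ᵇ ℂ) →L[ℂ] ℂ),
      ∀ u, a u = A (embed l u) := by
  obtain ⟨s, C, -, h⟩ := Seminorm.bound_of_continuous (S.withSeminorms ω d)
    ((normSeminorm ℂ ℂ).comp a.toLinearMap) (continuous_norm.comp a.continuous)
  obtain ⟨l, D, hD, hs⟩ := finset_sup_seminormFamily_le (d := d) (ω := ω) s
  have hb : ∀ u, ‖a u‖ ≤ C * D * ‖embed l u‖ := fun u => by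
    rw [mul_assoc]
    exact (h u).trans (mul_le_mul_of_nonneg_left (hs u) C.2)
  -- By injectivity `a` is a functional on the range of the embedding, bounded there by `hb`;
  -- Hahn–Banach extends it to the whole Banach space.
  let e := LinearEquiv.ofInjective (embed l : S ω d →ₗ[ℂ] _) (embed_injective l)
  let f : LinearMap.range (embed l : S ω d →ₗ[ℂ] _) →L[ℂ] ℂ :=
    LinearMap.mkContinuous (a.toLinearMap ∘ₗ e.symm.toLinearMap) (C * D) fun y => by
      have hy : embed l (e.symm y) = (y : (Euc d →ᵇ ℂ) × (Euc d →ᵇ ℂ)) :=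
        congrArg Subtype.val (e.apply_symm_apply y)
      have := hb (e.symm y)
      rw [hy] at this
      exact this
  obtain ⟨A, hA, -⟩ := exists_extension_norm_eq _ f
  refine ⟨l, A, fun u => ?_⟩
  have : A (embed l u) = f (e u) := hA (e u)
  rw [this]
  exact (congrArg a (e.symm_apply_apply u)).symm

end Embedding

/-! ### Norm continuity and growth of time-frequency shifts. -/

section Continuity

open scoped BoundedContinuousFunction

lemma norm_char_sub_le (y c c' : Euc d) :
    ‖Complex.exp (-(Complex.I * ((inner ℝ y c : ℝ) : ℂ))) -
      Complex.exp (-(Complex.I * ((inner ℝ y c' : ℝ) : ℂ)))‖ ≤ ‖y‖ * ‖c - c'‖ := by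
  have h : Complex.exp (-(Complex.I * ((inner ℝ y c : ℝ) : ℂ))) -
      Complex.exp (-(Complex.I * ((inner ℝ y c' : ℝ) : ℂ))) =
      Complex.exp (-(Complex.I * ((inner ℝ y c' : ℝ) : ℂ))) *
        (Complex.exp (Complex.I * ((inner ℝ y (c' - c) : ℝ) : ℂ)) - 1) := by
    rw [mul_sub, ← Complex.exp_add, mul_one, inner_sub_right]
    congr 2; push_cast; ring
  rw [h, norm_mul, norm_char, one_mul]
  refine Real.norm_exp_I_mul_ofReal_sub_one_le.trans ?_
  rw [norm_sub_rev c c']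
  exact abs_real_inner_le_norm y (c' - c)

lemma exp_weight_le_of_norm_sub_le {l R : ℝ} (hl : 0 ≤ l) {y w : Euc d} (h : ‖y - w‖ ≤ R) :
    Real.exp (l * ω ‖y‖) ≤ Real.exp (l * ω R) * Real.exp (l * ω ‖w‖) := by
  have h1 := exp_weight_add_le (ω := ω) hl (y - w) w
  rw [sub_add_cancel] at h1
  refine h1.trans ?_
  gcongr
  exact ω.monotoneOn (norm_nonneg _) ((norm_nonneg _).trans h) h

/-- Translations are handled by the mean value inequality and the decay of the first derivative.
Modulations lose a factor ‖y‖, absorbed by a larger exponent. The constant is uniform only for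
translations in a ball, which suffices for continuity. -/
lemma exp_weight_mul_timeFrequency_sub_le {f : Euc d → ℂ} (hf : ContDiff ℝ (⊤ : ℕ∞) f)
    (hd : RapidDecay ω f) {l : ℝ} (hl : 0 < l) (R : ℝ) :
    ∃ K, ∀ b b' c c' : Euc d, ‖b‖ ≤ R → ‖b'‖ ≤ R → ∀ y,
      Real.exp (l * ω ‖y‖) *
        ‖Complex.exp (-(Complex.I * ((inner ℝ y c : ℝ) : ℂ))) * f (y - b) -
          Complex.exp (-(Complex.I * ((inner ℝ y c' : ℝ) : ℂ))) * f (y - b')‖ ≤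
        K * (‖b - b'‖ + ‖c - c'‖) := by
  obtain ⟨m, C, hm, hC, hnorm⟩ := exists_norm_le_exp_weight (d := d) (ω := ω)
  obtain ⟨C₁, hC₁, h₁⟩ := hd.exists_bound hl 1
  obtain ⟨C₂, hC₂, h₂⟩ := hd.exists_bound (add_pos hl hm) 0
  simp only [norm_iteratedFDeriv_zero] at h₂
  set K₁ := Real.exp (l * ω R) * C₁
  set K₂ := C * (Real.exp ((l + m) * ω R) * C₂)
  have hK₁ : 0 ≤ K₁ := by positivity
  have hK₂ : 0 ≤ K₂ := by positivity
  refine ⟨K₁ + K₂, fun b b' c c' hb hb' y => ?_⟩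
  set E := Real.exp (l * ω ‖y‖) with hE
  have hE0 : 0 < E := Real.exp_pos _
  have hA : E * ‖f (y - b) - f (y - b')‖ ≤ K₁ * ‖b - b'‖ := by
    rw [← le_div_iff₀' hE0]
    -- The ball of radius R about y contains both points y - b and y - b', and on it the weight is
    -- comparable to its value at y.
    have := Convex.norm_image_sub_le_of_norm_fderiv_le (𝕜 := ℝ) (f := f)
      (s := Metric.closedBall y R) (x := y - b') (y := y - b) (C := K₁ / E)
      (fun z _ => (hf.differentiable (by simp)).differentiableAt) (fun w hw => by
        have hw' : ‖y - w‖ ≤ R := by rw [norm_sub_rev]; exact mem_closedBall_iff_norm.1 hw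
        rw [le_div_iff₀' hE0]
        have h := h₁ w
        rw [← norm_iteratedFDeriv_fderiv, norm_iteratedFDeriv_zero] at h
        calc E * ‖fderiv ℝ f w‖
            ≤ Real.exp (l * ω R) * Real.exp (l * ω ‖w‖) * ‖fderiv ℝ f w‖ := by
              gcongr; exact exp_weight_le_of_norm_sub_le hl.le hw'
          _ ≤ _ := by
              rw [mul_assoc]; exact mul_le_mul_of_nonneg_left h (Real.exp_pos _).le)
      (convex_closedBall _ _) (by simpa using hb') (by simpa using hb)
    rw [show y - b - (y - b') = b' - b by abel, norm_sub_rev b' b] at this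
    rwa [mul_div_right_comm]
  have hB : E * (‖y‖ * ‖f (y - b')‖) ≤ K₂ :=
    calc E * (‖y‖ * ‖f (y - b')‖)
        ≤ E * ((C * Real.exp (m * ω ‖y‖)) * ‖f (y - b')‖) := by gcongr; exact hnorm y
      _ = C * (Real.exp ((l + m) * ω ‖y‖) * ‖f (y - b')‖) := by
          rw [add_mul, Real.exp_add]; ring
      _ ≤ C * (Real.exp ((l + m) * ω R) * Real.exp ((l + m) * ω ‖y - b'‖) * ‖f (y - b')‖) := by
          gcongr
          exact exp_weight_le_of_norm_sub_le (by positivity) (by simpa using hb')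
      _ ≤ _ := by
          rw [mul_assoc (Real.exp ((l + m) * ω R))]
          exact mul_le_mul_of_nonneg_left
            (mul_le_mul_of_nonneg_left (h₂ _) (Real.exp_pos _).le) hC
  set e := Complex.exp (-(Complex.I * ((inner ℝ y c : ℝ) : ℂ))) with he
  set e' := Complex.exp (-(Complex.I * ((inner ℝ y c' : ℝ) : ℂ))) with he'
  have hsplit : ‖e * f (y - b) - e' * f (y - b')‖ ≤
      ‖f (y - b) - f (y - b')‖ + ‖y‖ * ‖c - c'‖ * ‖f (y - b')‖ :=
    calc _ = ‖e * (f (y - b) - f (y - b')) + (e - e') * f (y - b')‖ := by congr 1; ring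
      _ ≤ ‖e * (f (y - b) - f (y - b'))‖ + ‖(e - e') * f (y - b')‖ := norm_add_le _ _
      _ ≤ _ := by
          rw [norm_mul, norm_mul, he, norm_char, one_mul]
          gcongr
          exact norm_char_sub_le y c c'
  calc _ ≤ E * (‖f (y - b) - f (y - b')‖ + ‖y‖ * ‖c - c'‖ * ‖f (y - b')‖) := by gcongr
    _ = E * ‖f (y - b) - f (y - b')‖ + E * (‖y‖ * ‖f (y - b')‖) * ‖c - c'‖ := by ring
    _ ≤ K₁ * ‖b - b'‖ + K₂ * ‖c - c'‖ := by gcongr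
    _ ≤ _ := by
        have := mul_nonneg hK₁ (norm_nonneg (c - c'))
        have := mul_nonneg hK₂ (norm_nonneg (b - b'))
        nlinarith

lemma continuous_weightedBCF_timeFrequency (l : Set.Ioi (0 : ℝ)) {f : Euc d → ℂ}
    (hf : ContDiff ℝ (⊤ : ℕ∞) f) (hd : RapidDecay ω f) {G : Euc d × Euc d → Euc d →ᵇ ℂ}
    (hG : ∀ p y, G p y = (Real.exp (l * ω ‖y‖) : ℂ) *
      (Complex.exp (-(Complex.I * ((inner ℝ y p.2 : ℝ) : ℂ))) * f (y - p.1))) :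
    Continuous G := by
  refine continuous_iff_continuousAt.2 fun p₀ => ?_
  obtain ⟨K, hK⟩ := exp_weight_mul_timeFrequency_sub_le hf hd l.2 (‖p₀‖ + 1)
  have hev : ∀ᶠ p in 𝓝 p₀, ‖p‖ < ‖p₀‖ + 1 :=
    continuous_norm.continuousAt.eventually_lt_const (by linarith)
  refine tendsto_iff_dist_tendsto_zero.2 (squeeze_zero' (Eventually.of_forall fun _ => dist_nonneg)
    (g := fun p => K * (‖p.1 - p₀.1‖ + ‖p.2 - p₀.2‖)) ?_ ?_)
  · filter_upwards [hev] with p hp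
    have hb : ∀ y, dist (G p y) (G p₀ y) ≤ K * (‖p.1 - p₀.1‖ + ‖p.2 - p₀.2‖) := fun y => by
      rw [dist_eq_norm, hG, hG, ← mul_sub, norm_exp_weight_mul]
      exact hK _ _ _ _ ((norm_fst_le p).trans hp.le) ((norm_fst_le p₀).trans (by linarith)) y
    exact (BoundedContinuousFunction.dist_le (dist_nonneg.trans (hb 0))).2 hb
  · have : Continuous fun p : Euc d × Euc d => K * (‖p.1 - p₀.1‖ + ‖p.2 - p₀.2‖) := by fun_prop
    simpa using this.tendsto p₀

lemma conj_modulate_translate_val (γ : S ω d) (x ξ y : Euc d) :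
    (S.conj (S.modulate ξ (S.translate x γ))).val y =
      Complex.exp (-(Complex.I * ((inner ℝ y ξ : ℝ) : ℂ))) * γ.conj.val (y - x) := by
  simp [S.conj, S.modulate, S.translate, S.val_mk, ← Complex.exp_conj]

/-- Up to a unimodular constant, the Fourier transform exchanges translation and modulation; the
Fourier component of the embedding is therefore again a time-frequency shift. -/
lemma fourier_conj_modulate_translate (γ : S ω d) (x ξ η : Euc d) :
    fourier (S.conj (S.modulate ξ (S.translate x γ))).val η =
      Complex.exp (-(Complex.I * ((inner ℝ x ξ : ℝ) : ℂ))) *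
        (Complex.exp (-(Complex.I * ((inner ℝ η x : ℝ) : ℂ))) *
          fourier γ.conj.val (η - (-ξ))) := by
  have h : (S.conj (S.modulate ξ (S.translate x γ))).val = fun y =>
      Complex.exp (-(Complex.I * ((inner ℝ y ξ : ℝ) : ℂ))) * γ.conj.val (y - x) :=
    funext fun y => conj_modulate_translate_val γ x ξ y
  rw [h, fourier_mul_char (fun y => γ.conj.val (y - x)) ξ, fourier_translate, ← mul_assoc,
    ← Complex.exp_add]
  simp only [sub_neg_eq_add, inner_add_left, real_inner_comm x ξ]
  congr 2; push_cast; ring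

lemma continuous_embed_conj_modulate_translate (l : Set.Ioi (0 : ℝ)) (γ : S ω d) :
    Continuous fun p : Euc d × Euc d => embed l (S.conj (S.modulate p.2 (S.translate p.1 γ))) := by
  refine Continuous.prodMk (continuous_weightedBCF_timeFrequency l γ.conj.memS.contDiff
    γ.conj.memS.decay fun p y => ?_) ?_
  · rw [← conj_modulate_translate_val]; rfl
  · let G : Euc d × Euc d → Euc d →ᵇ ℂ := fun p =>
      weightedBCF l _ (S.translate p.1 γ.conj.fourierS |>.memS_mul_char p.2).contDiff
        (S.translate p.1 γ.conj.fourierS |>.memS_mul_char p.2).decay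
    have hG : Continuous G := continuous_weightedBCF_timeFrequency l
      γ.conj.memS.contDiff_fourier γ.conj.memS.decay_fourier fun p y => rfl
    have he : Continuous fun p : Euc d × Euc d =>
        Complex.exp (-(Complex.I * ((inner ℝ p.1 p.2 : ℝ) : ℂ))) := by fun_prop
    have hc : Continuous fun p : Euc d × Euc d =>
        Complex.exp (-(Complex.I * ((inner ℝ p.1 p.2 : ℝ) : ℂ))) • G (-p.2, p.1) :=
      he.smul (hG.comp (continuous_snd.neg.prodMk continuous_fst))
    convert hc using 1
    funext p
    ext y
    change (Real.exp (l * ω ‖y‖) : ℂ) * fourier _ y = _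
    rw [fourier_conj_modulate_translate, mul_left_comm]
    rfl

lemma continuous_stft (γ : S ω d) (a : Dist ω d) :
    Continuous fun p : Euc d × Euc d => stft γ a p.1 p.2 := by
  obtain ⟨l, A, hA⟩ := a.exists_factorization
  simp only [stft, hA]
  exact A.continuous.comp (continuous_embed_conj_modulate_translate l γ)

/-- The growth is beaten by the decay of V_γ u, which makes the vector-valued inversion integral
converge absolutely. -/
lemma norm_embed_conj_modulate_translate_le (l : Set.Ioi (0 : ℝ)) (γ : S ω d) (x ξ : Euc d) :
    ‖embed l (S.conj (S.modulate ξ (S.translate x γ)))‖ ≤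
      ‖embed l γ.conj‖ * (Real.exp (l * ω ‖x‖) * Real.exp (l * ω ‖ξ‖)) := by
  have hx := one_le_exp_weight (ω := ω) (le_of_lt l.2) x
  have hξ := one_le_exp_weight (ω := ω) (le_of_lt l.2) ξ
  have key : ∀ (f : Euc d → ℂ) (b y : Euc d),
      (∀ z, Real.exp (l * ω ‖z‖) * ‖f z‖ ≤ ‖embed l γ.conj‖) →
      Real.exp (l * ω ‖y‖) * ‖f (y - b)‖ ≤ ‖embed l γ.conj‖ * Real.exp (l * ω ‖b‖) :=
    fun f b y hf =>
    calc _ ≤ Real.exp (l * ω ‖b‖) * Real.exp (l * ω ‖y - b‖) * ‖f (y - b)‖ := by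
          gcongr; exact exp_weight_le_of_norm_sub_le (le_of_lt l.2) (by simp)
      _ ≤ _ := by rw [mul_assoc, mul_comm]; gcongr; exact hf _
  refine norm_embed_le (fun y => ?_) fun η => ?_
  · rw [conj_modulate_translate_val, norm_mul, norm_char, one_mul]
    refine (key _ x y (exp_weight_mul_le_norm_embed l _)).trans ?_
    gcongr
    exact le_mul_of_one_le_right (Real.exp_pos _).le hξ
  · rw [fourier_conj_modulate_translate, norm_mul, norm_mul, norm_char, norm_char, one_mul, one_mul]
    refine (key _ (-ξ) η (exp_weight_mul_fourier_le_norm_embed l _)).trans ?_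
    rw [norm_neg]
    gcongr
    exact le_mul_of_one_le_left (Real.exp_pos _).le hx

end Continuity

/-! ### Decay of the short-time Fourier transform of test functions. -/

section TestFunctions

namespace S

lemma exists_exp_weight_mul_le (u : S ω d) {l : ℝ} (hl : 0 < l) :
    ∃ C, 0 ≤ C ∧ ∀ x, Real.exp (l * ω ‖x‖) * ‖u.val x‖ ≤ C := by
  simpa using u.memS.decay.exists_bound hl 0

lemma exists_norm_le (u : S ω d) : ∃ C, 0 ≤ C ∧ ∀ x, ‖u.val x‖ ≤ C := by
  obtain ⟨C, hC, h⟩ := u.exists_exp_weight_mul_le one_pos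
  exact ⟨C, hC, fun x => (le_mul_of_one_le_left (norm_nonneg _)
    (one_le_exp_weight zero_le_one x)).trans (h x)⟩

lemma continuous_val (u : S ω d) : Continuous u.val := u.memS.contDiff.continuous

lemma integrable_mul_translate (u v : S ω d) (t : Euc d) :
    Integrable fun y => u.val y * v.val (y - t) := by
  obtain ⟨C, -, hC⟩ := u.exists_norm_le
  exact (v.memS.integrable.comp_sub_right t).bdd_mul u.continuous_val.aestronglyMeasurable
    (Eventually.of_forall hC)

lemma conj_val (u : S ω d) (x : Euc d) : u.conj.val x = starRingEnd ℂ (u.val x) := rfl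

lemma norm_conj_val (u : S ω d) (x : Euc d) : ‖u.conj.val x‖ = ‖u.val x‖ :=
  RCLike.norm_conj _

end S

/-- The short-time Fourier transform `V_γ ψ(t, η) = ∫ ψ(y) \overline{γ(y - t)} e^{-i y·η} dy` of a
test function. -/
def stftFun (γ ψ : S ω d) (t η : Euc d) : ℂ :=
  fourier (fun y => ψ.val y * γ.conj.val (y - t)) η

lemma continuous_stftFun (γ ψ : S ω d) :
    Continuous fun p : Euc d × Euc d => stftFun γ ψ p.1 p.2 := by
  obtain ⟨C, hC0, hC⟩ := γ.conj.exists_norm_le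
  have h1 := ψ.continuous_val
  have h2 := γ.conj.continuous_val
  refine continuous_of_dominated (bound := fun y => ‖ψ.val y‖ * C) (fun p => ?_) (fun p => ?_)
    (ψ.memS.integrable.norm.mul_const C) (Eventually.of_forall fun y => ?_)
  · exact Continuous.aestronglyMeasurable (by fun_prop)
  · refine Eventually.of_forall fun y => ?_
    rw [norm_mul, norm_char, one_mul, norm_mul]
    exact mul_le_mul_of_nonneg_left (hC _) (norm_nonneg _)
  · fun_prop

/-- From ω(t) ≤ ω(y - t) + ω(y) under the integral: one part of the weight goes to γ, the other to
ψ. -/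
lemma exp_weight_time_mul_stftFun_le (γ ψ : S ω d) {l A : ℝ} (hl : 0 < l)
    (hA : ∀ y, Real.exp (l * ω ‖y‖) * ‖ψ.val y‖ ≤ A) (t η : Euc d) :
    Real.exp (l * ω ‖t‖) * ‖stftFun γ ψ t η‖ ≤
      (∫ y, Real.exp (l * ω ‖y‖) * ‖γ.val y‖) * A := by
  have hA0 : 0 ≤ A := le_trans (by positivity) (hA 0)
  refine (mul_le_mul_of_nonneg_left (norm_integral_le_integral_norm _) (Real.exp_pos _).le).trans ?_
  rw [← integral_sub_right_eq_self (fun y => Real.exp (l * ω ‖y‖) * ‖γ.val y‖) t,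
    ← integral_const_mul, ← integral_mul_const]
  refine integral_mono_of_nonneg (Eventually.of_forall fun y => by positivity)
    (((S.integrable_weight_mul γ hl).comp_sub_right t).mul_const A)
    (Eventually.of_forall fun y => ?_)
  have h := exp_weight_add_le (ω := ω) hl.le (t - y) y
  rw [sub_add_cancel, norm_sub_rev] at h
  simp only [norm_mul, norm_char, one_mul, S.norm_conj_val]
  calc _ ≤ (Real.exp (l * ω ‖y - t‖) * Real.exp (l * ω ‖y‖)) *
        (‖ψ.val y‖ * ‖γ.val (y - t)‖) := by gcongr
    _ = Real.exp (l * ω ‖y - t‖) * ‖γ.val (y - t)‖ * (Real.exp (l * ω ‖y‖) * ‖ψ.val y‖) := by ring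
    _ ≤ _ := by gcongr; exact hA y

/-- The Fourier transform of a product is a convolution; this form gives decay in η just as the
defining integral gives decay in t. -/
lemma stftFun_eq_integral_fourier (γ ψ : S ω d) (t η : Euc d) :
    stftFun γ ψ t η = inversionConst d *
      ∫ ζ, fourier ψ.val ζ * fourier (fun y => γ.conj.val (y - t)) (η - ζ) := by
  have hc2 := γ.conj.continuous_val
  have hc1 : Continuous (fourier ψ.val) := ψ.memS.contDiff_fourier.continuous
  have hint : Integrable (fun p : Euc d × Euc d =>
      Complex.exp (-(Complex.I * ((inner ℝ p.1 η : ℝ) : ℂ))) *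
        Complex.exp (-(Complex.I * ((inner ℝ p.2 (-p.1) : ℝ) : ℂ))) *
        (γ.conj.val (p.1 - t) * fourier ψ.val p.2)) (volume.prod volume) := by
    refine Integrable.bdd_mul (c := 1)
      ((γ.conj.memS.integrable.comp_sub_right t).mul_prod ψ.integrable_fourier)
      (Continuous.aestronglyMeasurable (by fun_prop)) (Eventually.of_forall fun p => ?_)
    rw [norm_mul, norm_char, norm_char, one_mul]
  have hL : stftFun γ ψ t η = inversionConst d * ∫ y, ∫ ζ,
      Complex.exp (-(Complex.I * ((inner ℝ y η : ℝ) : ℂ))) *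
        Complex.exp (-(Complex.I * ((inner ℝ ζ (-y) : ℝ) : ℂ))) *
        (γ.conj.val (y - t) * fourier ψ.val ζ) := by
    rw [stftFun, fourier, ← integral_const_mul]
    refine integral_congr_ae (Eventually.of_forall fun y => ?_)
    simp only
    rw [ψ.inversion y, fourier, ← integral_const_mul, ← integral_mul_const, ← integral_const_mul,
      ← integral_const_mul]
    exact integral_congr_ae (Eventually.of_forall fun ζ => by ring)
  rw [hL, integral_integral_swap hint]
  congr 1
  refine integral_congr_ae (Eventually.of_forall fun ζ => ?_)
  have hf : fourier (fun y => γ.conj.val (y - t)) (η - ζ) = ∫ y,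
      Complex.exp (-(Complex.I * ((inner ℝ y (η - ζ) : ℝ) : ℂ))) * γ.conj.val (y - t) := rfl
  simp only
  rw [hf, ← integral_const_mul]
  refine integral_congr_ae (Eventually.of_forall fun y => ?_)
  simp only [← Complex.exp_add, inner_sub_right, inner_neg_right, real_inner_comm ζ y]
  have : -(Complex.I * ((inner ℝ y η - inner ℝ ζ y : ℝ) : ℂ)) =
      -(Complex.I * ((inner ℝ y η : ℝ) : ℂ)) + -(Complex.I * ((-inner ℝ ζ y : ℝ) : ℂ)) := by
    push_cast; ring
  rw [this]; ring

lemma exp_weight_frequency_mul_stftFun_le (γ ψ : S ω d) {l B : ℝ} (hl : 0 < l)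
    (hB : ∀ ζ, Real.exp (l * ω ‖ζ‖) * ‖fourier ψ.val ζ‖ ≤ B) (t η : Euc d) :
    Real.exp (l * ω ‖η‖) * ‖stftFun γ ψ t η‖ ≤
      (inversionConst d * ∫ ζ, Real.exp (l * ω ‖ζ‖) * ‖fourier γ.conj.val ζ‖) * B := by
  have hB0 : 0 ≤ B := le_trans (by positivity) (hB 0)
  rw [stftFun_eq_integral_fourier, norm_mul, Complex.norm_of_nonneg inversionConst_pos.le,
    mul_left_comm, mul_assoc]
  refine mul_le_mul_of_nonneg_left ?_ inversionConst_pos.le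
  refine (mul_le_mul_of_nonneg_left (norm_integral_le_integral_norm _) (Real.exp_pos _).le).trans ?_
  rw [← integral_sub_left_eq_self (fun ζ => Real.exp (l * ω ‖ζ‖) * ‖fourier γ.conj.val ζ‖) _ η,
    ← integral_const_mul, ← integral_mul_const]
  refine integral_mono_of_nonneg (Eventually.of_forall fun y => by positivity)
    (((S.integrable_weight_mul γ.conj.fourierS hl).comp_sub_left η).mul_const B)
    (Eventually.of_forall fun ζ => ?_)
  have h := exp_weight_add_le (ω := ω) hl.le (η - ζ) ζ
  rw [sub_add_cancel] at h
  simp only [norm_mul, fourier_translate, norm_char, one_mul]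
  calc _ ≤ (Real.exp (l * ω ‖η - ζ‖) * Real.exp (l * ω ‖ζ‖)) *
        (‖fourier ψ.val ζ‖ * ‖fourier γ.conj.val (η - ζ)‖) := by gcongr
    _ = Real.exp (l * ω ‖η - ζ‖) * ‖fourier γ.conj.val (η - ζ)‖ *
        (Real.exp (l * ω ‖ζ‖) * ‖fourier ψ.val ζ‖) := by ring
    _ ≤ _ := by gcongr; exact hB ζ

/-- The product of the time bound and the frequency bound, each with weight 2l, so that decay in
both variables is their geometric mean. The constant does not depend on ψ, and A and B stay separate
so that smallness of B alone can be used. -/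
lemma exists_stftFun_bound (γ : S ω d) {l : ℝ} (hl : 0 < l) :
    ∃ C, 0 ≤ C ∧ ∀ (ψ : S ω d) (A B : ℝ),
      (∀ y, Real.exp (2 * l * ω ‖y‖) * ‖ψ.val y‖ ≤ A) →
      (∀ ζ, Real.exp (2 * l * ω ‖ζ‖) * ‖fourier ψ.val ζ‖ ≤ B) → ∀ t η,
      (Real.exp (l * ω ‖t‖) * Real.exp (l * ω ‖η‖) * ‖stftFun γ ψ t η‖) ^ 2 ≤ C * (A * B) := by
  set C₁ := ∫ y, Real.exp (2 * l * ω ‖y‖) * ‖γ.val y‖ with hC₁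
  set C₂ := inversionConst d * ∫ ζ, Real.exp (2 * l * ω ‖ζ‖) * ‖fourier γ.conj.val ζ‖ with hC₂
  have h₁ : 0 ≤ C₁ := integral_nonneg fun y => by positivity
  have h₂ : 0 ≤ C₂ := mul_nonneg inversionConst_pos.le (integral_nonneg fun y => by positivity)
  refine ⟨C₁ * C₂, by positivity, fun ψ A B hA hB t η => ?_⟩
  have hA0 : 0 ≤ A := le_trans (by positivity) (hA 0)
  have h2 : ∀ x : Euc d, Real.exp (2 * l * ω ‖x‖) = Real.exp (l * ω ‖x‖) ^ 2 := fun x => by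
    rw [← Real.exp_nat_mul]; congr 1; push_cast; ring
  calc _ = (Real.exp (2 * l * ω ‖t‖) * ‖stftFun γ ψ t η‖) *
        (Real.exp (2 * l * ω ‖η‖) * ‖stftFun γ ψ t η‖) := by rw [h2, h2]; ring
    _ ≤ (C₁ * A) * (C₂ * B) := by
        refine mul_le_mul (exp_weight_time_mul_stftFun_le γ ψ (by positivity) hA t η)
          (exp_weight_frequency_mul_stftFun_le γ ψ (by positivity) hB t η) (by positivity)
          (by positivity)
    _ = _ := by ring

lemma exists_norm_stftFun_le (γ ψ : S ω d) {l : ℝ} (hl : 0 < l) :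
    ∃ C, 0 ≤ C ∧ ∀ t η,
      Real.exp (l * ω ‖t‖) * Real.exp (l * ω ‖η‖) * ‖stftFun γ ψ t η‖ ≤ C := by
  obtain ⟨C, -, h⟩ := exists_stftFun_bound γ hl
  obtain ⟨A, -, hA⟩ := ψ.exists_exp_weight_mul_le (l := 2 * l) (by positivity)
  obtain ⟨B, -, hB⟩ := ψ.fourierS.exists_exp_weight_mul_le (l := 2 * l) (by positivity)
  exact ⟨_, Real.sqrt_nonneg _, fun t η => Real.le_sqrt_of_sq_le (h ψ A B hA hB t η)⟩

lemma integrable_exp_weight_prod :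
    ∃ m : ℝ, 0 < m ∧ ∀ l, m ≤ l → Integrable fun p : Euc d × Euc d =>
      Real.exp (-(l * ω ‖p.1‖)) * Real.exp (-(l * ω ‖p.2‖)) := by
  obtain ⟨m, hm, h⟩ := exists_integrable_exp_weight (d := d) (ω := ω)
  exact ⟨m, hm, fun l hl => (h l hl).mul_prod (h l hl)⟩

lemma integrable_exp_weight_mul_stftFun (γ ψ : S ω d) {l : ℝ} (hl : 0 ≤ l) :
    Integrable fun p : Euc d × Euc d =>
      Real.exp (l * ω ‖p.1‖) * Real.exp (l * ω ‖p.2‖) * ‖stftFun γ ψ p.1 p.2‖ := by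
  obtain ⟨m, hm, hi⟩ := integrable_exp_weight_prod (d := d) (ω := ω)
  obtain ⟨C, -, hC⟩ := exists_norm_stftFun_le γ ψ (add_pos_of_nonneg_of_pos hl hm)
  refine ((hi m le_rfl).const_mul C).mono' (Continuous.aestronglyMeasurable
    ((((continuous_exp_weight l).comp continuous_fst).mul
      ((continuous_exp_weight l).comp continuous_snd)).mul (continuous_stftFun γ ψ).norm))
    (Eventually.of_forall fun p => ?_)
  rw [Real.norm_of_nonneg (by positivity)]
  calc _ = Real.exp ((l + m) * ω ‖p.1‖) * Real.exp ((l + m) * ω ‖p.2‖) *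
        ‖stftFun γ ψ p.1 p.2‖ * (Real.exp (-(m * ω ‖p.1‖)) * Real.exp (-(m * ω ‖p.2‖))) := by
        rw [add_mul, add_mul, Real.exp_add, Real.exp_add, Real.exp_neg, Real.exp_neg]
        field_simp
    _ ≤ _ := mul_le_mul_of_nonneg_right (hC _ _) (by positivity)

lemma integrable_stftFun (γ ψ : S ω d) :
    Integrable fun p : Euc d × Euc d => stftFun γ ψ p.1 p.2 := by
  have h := integrable_exp_weight_mul_stftFun γ ψ le_rfl
  simp only [zero_mul, Real.exp_zero, one_mul] at h
  exact (integrable_norm_iff (continuous_stftFun γ ψ).aestronglyMeasurable).1 h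

lemma integrable_stftFun_right (γ ψ : S ω d) (t : Euc d) : Integrable (stftFun γ ψ t) := by
  obtain ⟨m, hm, hi⟩ := exists_integrable_exp_weight (d := d) (ω := ω)
  obtain ⟨C, -, hC⟩ := exists_norm_stftFun_le γ ψ hm
  refine ((hi m le_rfl).const_mul C).mono' ((continuous_stftFun γ ψ).comp
    (by fun_prop : Continuous fun η : Euc d => (t, η))).aestronglyMeasurable
    (Eventually.of_forall fun η => ?_)
  calc ‖stftFun γ ψ t η‖
      = 1 * Real.exp (m * ω ‖η‖) * ‖stftFun γ ψ t η‖ * Real.exp (-(m * ω ‖η‖)) := by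
        rw [Real.exp_neg]; field_simp
    _ ≤ Real.exp (m * ω ‖t‖) * Real.exp (m * ω ‖η‖) * ‖stftFun γ ψ t η‖ *
          Real.exp (-(m * ω ‖η‖)) := by
        gcongr; exact one_le_exp_weight hm.le t
    _ ≤ _ := by gcongr; exact hC t η

end TestFunctions

/-! ### Inversion of the short-time Fourier transform and change of window. -/

section ChangeOfWindow

open scoped BoundedContinuousFunction

/-- The factor `(2π)^d ‖γ‖²` of the inversion formula of the short-time Fourier transform. -/
def windowConst (γ : S ω d) : ℝ := (inversionConst d)⁻¹ * ∫ y, ‖γ.val y‖ ^ 2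

lemma integrable_norm_sq (γ : S ω d) : Integrable fun y => ‖γ.val y‖ ^ 2 := by
  obtain ⟨C, -, hC⟩ := γ.exists_norm_le
  have := γ.memS.integrable.norm.bdd_mul (c := C) γ.continuous_val.norm.aestronglyMeasurable
    (Eventually.of_forall fun y => by simpa using hC y)
  simpa only [sq] using this

lemma windowConst_pos {γ : S ω d} (hγ : γ ≠ 0) : 0 < windowConst γ := by
  refine mul_pos (inv_pos.2 inversionConst_pos) ?_
  rw [integral_pos_iff_support_of_nonneg (fun y => by positivity) (integrable_norm_sq γ)]
  obtain ⟨y, hy⟩ : ∃ y, γ.val y ≠ 0 := by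
    by_contra! h
    exact hγ (S.ext (funext h))
  exact (γ.continuous_val.norm.pow 2).isOpen_support.measure_pos _ ⟨y, by simpa using hy⟩

lemma integrable_stftFun_mul_conj_modulate_translate (γ u : S ω d) :
    Integrable (fun q : (Euc d × Euc d) × Euc d => starRingEnd ℂ (stftFun γ u q.1.1 q.1.2) *
      (S.conj (S.modulate q.1.2 (S.translate q.1.1 γ))).val q.2) (volume.prod volume) := by
  have h1 := continuous_stftFun γ u
  have h2 := γ.conj.continuous_val
  have hc : Continuous fun q : (Euc d × Euc d) × Euc d =>
      starRingEnd ℂ (stftFun γ u q.1.1 q.1.2) *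
      (S.conj (S.modulate q.1.2 (S.translate q.1.1 γ))).val q.2 := by
    simp only [conj_modulate_translate_val]
    have h3 : Continuous fun q : (Euc d × Euc d) × Euc d => stftFun γ u q.1.1 q.1.2 :=
      h1.comp continuous_fst
    have h4 := Complex.continuous_conj.comp h3
    refine h4.mul ?_
    fun_prop
  refine (integrable_prod_iff hc.aestronglyMeasurable).2 ⟨Eventually.of_forall fun p => ?_, ?_⟩
  · exact (S.conj (S.modulate p.2 (S.translate p.1 γ))).memS.integrable.const_mul
      (starRingEnd ℂ (stftFun γ u p.1 p.2))
  · simp only [norm_mul, conj_modulate_translate_val, norm_char, one_mul, integral_const_mul,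
      RCLike.norm_conj]
    have : ∀ x : Euc d, ∫ y, ‖γ.conj.val (y - x)‖ = ∫ y, ‖γ.conj.val y‖ := fun x =>
      integral_sub_right_eq_self (fun y => ‖γ.conj.val y‖) x
    simp only [this]
    exact (integrable_stftFun γ u).norm.mul_const _

/-- For fixed x, V_γ u(x, ·) is the Fourier transform of y ↦ u(y) conj γ(y - x), so Fourier
inversion in ξ leaves the conjugate of u(y) times |γ(y - x)|²; integrating in x gives ‖γ‖². -/
lemma integral_stftFun_mul_conj_modulate_translate (γ u : S ω d) (y : Euc d) :
    ∫ p : Euc d × Euc d, starRingEnd ℂ (stftFun γ u p.1 p.2) *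
      (S.conj (S.modulate p.2 (S.translate p.1 γ))).val y = windowConst γ * u.conj.val y := by
  have hc : (inversionConst d : ℂ) ≠ 0 := by exact_mod_cast inversionConst_pos.ne'
  have h1 := continuous_stftFun γ u
  have h2 := γ.conj.continuous_val
  obtain ⟨C, -, hC⟩ := γ.conj.exists_norm_le
  have hint : Integrable (fun p : Euc d × Euc d => starRingEnd ℂ (stftFun γ u p.1 p.2) *
      (S.conj (S.modulate p.2 (S.translate p.1 γ))).val y) (volume.prod volume) := by
    simp only [conj_modulate_translate_val]
    refine Integrable.mul_bdd (c := C) ?_ (Continuous.aestronglyMeasurable (by fun_prop))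
      (Eventually.of_forall fun p => ?_)
    · exact Complex.conjLIE.toContinuousLinearEquiv.toContinuousLinearMap.integrable_comp
        (integrable_stftFun γ u)
    · rw [norm_mul, norm_char, one_mul]; exact hC _
  have hinner : ∀ x, ∫ ξ, starRingEnd ℂ (stftFun γ u x ξ) *
      (S.conj (S.modulate ξ (S.translate x γ))).val y =
      ((inversionConst d)⁻¹ : ℂ) * u.conj.val y * ((‖γ.val (y - x)‖ ^ 2 : ℝ) : ℂ) := fun x => by
    have hcont : Continuous fun y => u.val y * γ.conj.val (y - x) :=
      u.continuous_val.mul (h2.comp (continuous_sub_right x))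
    have hinv := fourier_inversion hcont (S.integrable_mul_translate u γ.conj x)
      (integrable_stftFun_right γ u x) y
    have hconj : ∫ ξ, starRingEnd ℂ (stftFun γ u x ξ) *
        (S.conj (S.modulate ξ (S.translate x γ))).val y =
        starRingEnd ℂ (fourier (stftFun γ u x) (-y)) * γ.conj.val (y - x) := by
      rw [fourier, ← integral_conj, ← integral_mul_const]
      refine integral_congr_ae (Eventually.of_forall fun ξ => ?_)
      simp only [conj_modulate_translate_val, map_mul, ← Complex.exp_conj, real_inner_comm ξ y]
      have : starRingEnd ℂ (-(Complex.I * ((inner ℝ ξ (-y) : ℝ) : ℂ))) =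
          -(Complex.I * ((inner ℝ ξ y : ℝ) : ℂ)) := by
        simp
      rw [this]; ring
    have hinv' : fourier (stftFun γ u x) (-y) =
        (inversionConst d : ℂ)⁻¹ * (u.val y * γ.conj.val (y - x)) := by
      rw [hinv, inv_mul_cancel_left₀ hc]; rfl
    rw [hconj, hinv', S.conj_val, S.conj_val]
    have hsq : ((‖γ.val (y - x)‖ ^ 2 : ℝ) : ℂ) =
        γ.val (y - x) * starRingEnd ℂ (γ.val (y - x)) := by
      rw [Complex.mul_conj, Complex.normSq_eq_norm_sq]
    rw [hsq]
    simp only [map_mul, map_inv₀, Complex.conj_ofReal, Complex.conj_conj]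
    ring
  rw [Measure.volume_eq_prod, integral_prod _ hint]
  simp only [hinner]
  rw [integral_const_mul, integral_complex_ofReal,
    integral_sub_left_eq_self (fun x => ‖γ.val x‖ ^ 2) volume y, windowConst]
  push_cast; ring

lemma integral_stftFun_mul_fourier_conj_modulate_translate (γ u : S ω d) (η : Euc d) :
    ∫ p : Euc d × Euc d, starRingEnd ℂ (stftFun γ u p.1 p.2) *
      fourier (S.conj (S.modulate p.2 (S.translate p.1 γ))).val η =
        windowConst γ * fourier u.conj.val η := by
  have hint : Integrable (fun q : (Euc d × Euc d) × Euc d =>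
      Complex.exp (-(Complex.I * ((inner ℝ q.2 η : ℝ) : ℂ))) *
      (starRingEnd ℂ (stftFun γ u q.1.1 q.1.2) *
      (S.conj (S.modulate q.1.2 (S.translate q.1.1 γ))).val q.2)) (volume.prod volume) :=
    (integrable_stftFun_mul_conj_modulate_translate γ u).bdd_mul (c := 1)
      (Continuous.aestronglyMeasurable (by fun_prop))
      (Eventually.of_forall fun q => (norm_char q.2 η).le)
  have h1 : ∀ p : Euc d × Euc d, starRingEnd ℂ (stftFun γ u p.1 p.2) *
      fourier (S.conj (S.modulate p.2 (S.translate p.1 γ))).val η =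
      ∫ y, Complex.exp (-(Complex.I * ((inner ℝ y η : ℝ) : ℂ))) *
        (starRingEnd ℂ (stftFun γ u p.1 p.2) *
          (S.conj (S.modulate p.2 (S.translate p.1 γ))).val y) := fun p => by
    rw [fourier, ← integral_const_mul]
    exact integral_congr_ae (Eventually.of_forall fun y => by ring)
  simp only [h1]
  rw [integral_integral_swap hint, fourier, ← integral_const_mul]
  refine integral_congr_ae (Eventually.of_forall fun y => ?_)
  simp only
  rw [integral_const_mul, integral_stftFun_mul_conj_modulate_translate]
  ring

/-- The inversion formula of the short-time Fourier transform, paired with a distribution. -/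
lemma Dist.apply_conj_eq_integral (a : Dist ω d) (γ u : S ω d) :
    windowConst γ * a u.conj =
      ∫ p : Euc d × Euc d, starRingEnd ℂ (stftFun γ u p.1 p.2) * stft γ a p.1 p.2 := by
  obtain ⟨l, A, hA⟩ := a.exists_factorization
  let F : Euc d × Euc d → (Euc d →ᵇ ℂ) × (Euc d →ᵇ ℂ) := fun p =>
    starRingEnd ℂ (stftFun γ u p.1 p.2) • embed l (S.conj (S.modulate p.2 (S.translate p.1 γ)))
  -- The space of bounded continuous functions need not be separable; strong measurability of the
  -- continuous `F` comes from its second countable domain.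
  have : SecondCountableTopologyEither (Euc d × Euc d) ((Euc d →ᵇ ℂ) × (Euc d →ᵇ ℂ)) :=
    secondCountableTopologyEither_of_left _ _
  have hF : Integrable F := by
    refine ((integrable_exp_weight_mul_stftFun γ u (le_of_lt l.2)).const_mul
      ‖embed l γ.conj‖).mono' (Continuous.aestronglyMeasurable
        ((Complex.continuous_conj.comp (continuous_stftFun γ u)).smul
          (continuous_embed_conj_modulate_translate l γ))) (Eventually.of_forall fun p => ?_)
    rw [norm_smul, RCLike.norm_conj]
    calc _ ≤ ‖stftFun γ u p.1 p.2‖ * (‖embed l γ.conj‖ *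
          (Real.exp (l * ω ‖p.1‖) * Real.exp (l * ω ‖p.2‖))) := by
          gcongr; exact norm_embed_conj_modulate_translate_le l γ p.1 p.2
      _ = _ := by ring
  -- Point evaluations are continuous and separate points, so the Bochner integral is identified by
  -- the two scalar inversion formulas.
  have hI : ∫ p, F p = embed l ((windowConst γ : ℂ) • u.conj) := by
    refine Prod.ext (BoundedContinuousFunction.ext fun y => ?_)
      (BoundedContinuousFunction.ext fun η => ?_)
    · have h := ((BoundedContinuousFunction.evalCLM ℂ y).comp
        (ContinuousLinearMap.fst ℂ (Euc d →ᵇ ℂ) (Euc d →ᵇ ℂ))).integral_comp_comm hF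
      refine h.symm.trans ?_
      rw [embed_fst_apply, S.val_smul, Pi.smul_apply, smul_eq_mul,
        ← integral_stftFun_mul_conj_modulate_translate, ← integral_const_mul]
      refine integral_congr_ae (Eventually.of_forall fun p => ?_)
      exact mul_left_comm _ _ _
    · have h := ((BoundedContinuousFunction.evalCLM ℂ η).comp
        (ContinuousLinearMap.snd ℂ (Euc d →ᵇ ℂ) (Euc d →ᵇ ℂ))).integral_comp_comm hF
      refine h.symm.trans ?_
      rw [embed_snd_apply, S.fourier_smul, Pi.smul_apply, smul_eq_mul,
        ← integral_stftFun_mul_fourier_conj_modulate_translate, ← integral_const_mul]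
      refine integral_congr_ae (Eventually.of_forall fun p => ?_)
      exact mul_left_comm _ _ _
  have h := A.integral_comp_comm hF
  rw [hI, ← hA, map_smul, smul_eq_mul] at h
  rw [← h]
  refine integral_congr_ae (Eventually.of_forall fun p => ?_)
  simp only [F, map_smul, smul_eq_mul, ← hA, stft]

lemma norm_stftFun_modulate_translate (γ ψ : S ω d) (x ξ t η : Euc d) :
    ‖stftFun γ (S.modulate ξ (S.translate x ψ)) (x + t) (ξ + η)‖ = ‖stftFun γ ψ t η‖ := by
  have h : stftFun γ (S.modulate ξ (S.translate x ψ)) (x + t) (ξ + η) =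
      Complex.exp (-(Complex.I * ((inner ℝ x η : ℝ) : ℂ))) * stftFun γ ψ t η := by
    simp only [stftFun, fourier]
    rw [← integral_const_mul, ← integral_add_right_eq_self _ x]
    refine integral_congr_ae (Eventually.of_forall fun y => ?_)
    simp only [S.modulate, S.translate, S.val_mk, add_sub_cancel_right,
      show y + x - (x + t) = y - t by abel, inner_add_right, inner_add_left]
    have : Complex.exp (-(Complex.I * ((inner ℝ x η : ℝ) : ℂ))) *
        Complex.exp (-(Complex.I * ((inner ℝ y η : ℝ) : ℂ))) =
        Complex.exp (-(Complex.I * ((inner ℝ y ξ + inner ℝ x ξ + (inner ℝ y η + inner ℝ x η) : ℝ)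
          : ℂ))) * Complex.exp (Complex.I * ((inner ℝ y ξ + inner ℝ x ξ : ℝ) : ℂ)) := by
      rw [← Complex.exp_add, ← Complex.exp_add]; congr 1; push_cast; ring
    linear_combination (-ψ.val y * γ.conj.val (y - t)) * this
  rw [h, norm_mul, norm_char, one_mul]

/-- Apply the inversion formula to M_ξ T_x ψ, shift the variable by (x, ξ), and use the covariance
of V_γ, whose phases vanish under the absolute value. -/
lemma enorm_stft_le_lintegral (a : Dist ω d) {γ : S ω d} (hγ : γ ≠ 0) (ψ : S ω d)
    (x ξ : Euc d) :
    ‖stft ψ a x ξ‖ₑ ≤ ENNReal.ofReal (windowConst γ)⁻¹ * ∫⁻ p : Euc d × Euc d,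
      ‖stftFun γ ψ p.1 p.2‖ₑ * ‖stft γ a (x + p.1) (ξ + p.2)‖ₑ := by
  have hκ := windowConst_pos hγ
  have h := a.apply_conj_eq_integral γ (S.modulate ξ (S.translate x ψ))
  have heq : stft ψ a x ξ = ((windowConst γ)⁻¹ : ℝ) * ∫ p : Euc d × Euc d,
      starRingEnd ℂ (stftFun γ (S.modulate ξ (S.translate x ψ)) p.1 p.2) * stft γ a p.1 p.2 := by
    have hκ' : (windowConst γ : ℂ) ≠ 0 := by exact_mod_cast hκ.ne'
    rw [← h, stft]; push_cast
    rw [inv_mul_cancel_left₀ hκ']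
  rw [heq, enorm_mul]
  have hc : ‖(((windowConst γ)⁻¹ : ℝ) : ℂ)‖ₑ = ENNReal.ofReal (windowConst γ)⁻¹ := by
    rw [← ofReal_norm, Complex.norm_of_nonneg (inv_nonneg.2 hκ.le)]
  rw [hc]
  gcongr
  refine (enorm_integral_le_lintegral_enorm _).trans_eq ?_
  have : (volume : Measure (Euc d × Euc d)).IsAddLeftInvariant := by
    rw [Measure.volume_eq_prod]; infer_instance
  rw [← lintegral_add_left_eq_self _ ((x, ξ) : Euc d × Euc d)]
  refine lintegral_congr fun p => ?_
  rw [enorm_mul]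
  congr 1
  rw [← ofReal_norm, ← ofReal_norm, RCLike.norm_conj]
  congr 1
  exact norm_stftFun_modulate_translate γ ψ x ξ p.1 p.2

end ChangeOfWindow

/-! ### The weight on phase space. -/

section JointWeight

lemma continuous_weight_uncurry (l : ℝ) :
    Continuous fun p : Euc d × Euc d => weight ω l p.1 p.2 := by
  refine Real.continuous_exp.comp (continuous_const.mul ?_)
  exact ω.continuousOn.comp_continuous (by fun_prop) fun p => Real.sqrt_nonneg _

/-- Subadditivity of ω applied to (x, ξ) = (x + t, ξ + η) - (t, η), with the norm of (t, η) bounded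
by ‖t‖ + ‖η‖ so that the shift contributes a product weight. -/
lemma weight_le_mul {l : ℝ} (hl : 0 ≤ l) (x ξ t η : Euc d) :
    weight ω l x ξ ≤
      Real.exp (l * ω ‖t‖) * Real.exp (l * ω ‖η‖) * weight ω l (x + t) (ξ + η) := by
  have htri : Real.sqrt (‖x‖ ^ 2 + ‖ξ‖ ^ 2) ≤
      ‖t‖ + (‖η‖ + Real.sqrt (‖x + t‖ ^ 2 + ‖ξ + η‖ ^ 2)) := by
    have hx : ‖x‖ ≤ ‖x + t‖ + ‖t‖ := by simpa using norm_sub_le (x + t) t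
    have hξ : ‖ξ‖ ≤ ‖ξ + η‖ + ‖η‖ := by simpa using norm_sub_le (ξ + η) η
    set r := Real.sqrt (‖x + t‖ ^ 2 + ‖ξ + η‖ ^ 2)
    have hr : r ^ 2 = ‖x + t‖ ^ 2 + ‖ξ + η‖ ^ 2 := Real.sq_sqrt (by positivity)
    have h1 : ‖x + t‖ ≤ r := Real.le_sqrt_of_sq_le (by nlinarith [sq_nonneg ‖ξ + η‖])
    have h2 : ‖ξ + η‖ ≤ r := Real.le_sqrt_of_sq_le (by nlinarith [sq_nonneg ‖x + t‖])
    refine Real.sqrt_le_iff.2 ⟨by positivity, ?_⟩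
    have hx2 : ‖x‖ ^ 2 ≤ (‖x + t‖ + ‖t‖) ^ 2 := by gcongr
    have hξ2 : ‖ξ‖ ^ 2 ≤ (‖ξ + η‖ + ‖η‖) ^ 2 := by gcongr
    have h3 := mul_le_mul_of_nonneg_left h1 (norm_nonneg t)
    have h4 := mul_le_mul_of_nonneg_left h2 (norm_nonneg η)
    have h5 := mul_nonneg (norm_nonneg t) (norm_nonneg η)
    nlinarith
  have hω : ω (Real.sqrt (‖x‖ ^ 2 + ‖ξ‖ ^ 2)) ≤
      ω ‖t‖ + (ω ‖η‖ + ω (Real.sqrt (‖x + t‖ ^ 2 + ‖ξ + η‖ ^ 2))) := by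
    refine (ω.monotoneOn (Real.sqrt_nonneg _) (Set.mem_Ici.2 (by positivity)) htri).trans ?_
    refine (ω.subadditive _ _ (norm_nonneg _) (by positivity)).trans ?_
    gcongr
    exact ω.subadditive _ _ (norm_nonneg _) (by positivity)
  rw [weight, weight, mul_assoc, ← Real.exp_add, ← Real.exp_add, ← mul_add, ← mul_add]
  exact Real.exp_le_exp.2 (mul_le_mul_of_nonneg_left hω hl)

lemma weightOne_le_weight {l : ℝ} (hl : 0 ≤ l) (x ξ : Euc d) :
    weightOne ω l x ≤ weight ω l x ξ := by
  refine Real.exp_le_exp.2 (mul_le_mul_of_nonneg_left ?_ hl)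
  refine ω.monotoneOn (norm_nonneg _) (Real.sqrt_nonneg _) (Real.le_sqrt_of_sq_le ?_)
  nlinarith [sq_nonneg ‖ξ‖]

end JointWeight

/-! ### Weighted change of window, bounds and limits. -/

section WeightedTransform

/-- The absolute value of the short-time Fourier transform times the weight `m_l`. -/
def weightedStft (l : ℝ) (γ : S ω d) (a : Dist ω d) (x ξ : Euc d) : ℝ≥0∞ :=
  ‖stft γ a x ξ‖ₑ * ENNReal.ofReal (weight ω l x ξ)

lemma enorm_stft_mul_weight (l : ℝ) (γ : S ω d) (a : Dist ω d) (x ξ : Euc d) :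
    ‖stft γ a x ξ * (weight ω l x ξ : ℂ)‖ₑ = weightedStft l γ a x ξ := by
  rw [enorm_mul, weightedStft]
  congr 1
  rw [← ofReal_norm, Complex.norm_of_nonneg (by unfold weight; positivity)]

lemma continuous_weightedStft (l : ℝ) (γ : S ω d) (a : Dist ω d) :
    Continuous fun p : Euc d × Euc d => weightedStft l γ a p.1 p.2 := by
  simp only [← enorm_stft_mul_weight]
  exact ((continuous_stft γ a).mul
    (Complex.continuous_ofReal.comp (continuous_weight_uncurry l))).enorm

/-- The weighted absolute value of the short-time Fourier transform of a test function. -/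
def windowKernel (l : ℝ) (γ ψ : S ω d) (p : Euc d × Euc d) : ℝ≥0∞ :=
  ENNReal.ofReal (Real.exp (l * ω ‖p.1‖) * Real.exp (l * ω ‖p.2‖) * ‖stftFun γ ψ p.1 p.2‖)

lemma measurable_windowKernel (l : ℝ) (γ ψ : S ω d) : Measurable (windowKernel l γ ψ) :=
  (ENNReal.continuous_ofReal.comp ((((continuous_exp_weight l).comp continuous_fst).mul
      ((continuous_exp_weight l).comp continuous_snd)).mul
        (continuous_stftFun γ ψ).norm)).measurable

lemma lintegral_windowKernel_lt_top {l : ℝ} (hl : 0 ≤ l) (γ ψ : S ω d) :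
    ∫⁻ p, windowKernel l γ ψ p < ∞ :=
  (integrable_exp_weight_mul_stftFun γ ψ hl).lintegral_lt_top

lemma weightedStft_le_lintegral {l : ℝ} (hl : 0 ≤ l) (a : Dist ω d) {γ : S ω d} (hγ : γ ≠ 0)
    (ψ : S ω d) (x ξ : Euc d) :
    weightedStft l ψ a x ξ ≤ ENNReal.ofReal (windowConst γ)⁻¹ * ∫⁻ p : Euc d × Euc d,
      windowKernel l γ ψ p * weightedStft l γ a (x + p.1) (ξ + p.2) := by
  rw [weightedStft]
  refine (mul_le_mul_left (enorm_stft_le_lintegral a hγ ψ x ξ) _).trans ?_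
  rw [mul_assoc, ← lintegral_mul_const' _ _ ENNReal.ofReal_ne_top]
  refine mul_le_mul_right (lintegral_mono fun p => ?_) _
  rw [windowKernel, weightedStft, ENNReal.ofReal_mul (by positivity), ofReal_norm]
  calc _ ≤ ‖stftFun γ ψ p.1 p.2‖ₑ * ‖stft γ a (x + p.1) (ξ + p.2)‖ₑ *
        (ENNReal.ofReal (Real.exp (l * ω ‖p.1‖) * Real.exp (l * ω ‖p.2‖)) *
          ENNReal.ofReal (weight ω l (x + p.1) (ξ + p.2))) := by
        rw [← ENNReal.ofReal_mul (by positivity)]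
        gcongr
        exact weight_le_mul hl x ξ p.1 p.2
    _ = _ := by ring

lemma weightedStft_le_of_bounded {l : ℝ} (hl : 0 ≤ l) (a : Dist ω d) {γ : S ω d} (hγ : γ ≠ 0)
    {N : ℝ≥0∞} (hN : ∀ x ξ, weightedStft l γ a x ξ ≤ N) (ψ : S ω d) (x ξ : Euc d) :
    weightedStft l ψ a x ξ ≤
      ENNReal.ofReal (windowConst γ)⁻¹ * ((∫⁻ p, windowKernel l γ ψ p) * N) := by
  refine (weightedStft_le_lintegral hl a hγ ψ x ξ).trans ?_
  rw [← lintegral_mul_const _ (measurable_windowKernel l γ ψ)]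
  gcongr with p
  exact hN _ _

/-- A set of full measure is dense, and the sublevel set is closed. This turns the essential suprema
in the mixed norms into bounds at every point. -/
lemma forall_le_of_ae_le {f : Euc d → ℝ≥0∞} (hf : Continuous f) {N : ℝ≥0∞}
    (h : ∀ᵐ x, f x ≤ N) (x : Euc d) : f x ≤ N := by
  have hd : Dense {x | f x ≤ N} := Measure.dense_of_ae h
  have hc : IsClosed {x | f x ≤ N} := isClosed_le hf continuous_const
  have : x ∈ closure {x | f x ≤ N} := hd x
  rwa [hc.closure_eq] at this

lemma exists_bound_weightedStft {l : ℝ} {φ : S ω d} {a : Dist ω d}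
    (ha : a ∈ modulationSpace l ∞ ∞ φ) :
    ∃ N, N < ∞ ∧ ∀ x ξ, weightedStft l φ a x ξ ≤ N := by
  refine ⟨_, ha.2, fun x => forall_le_of_ae_le
    ((continuous_weightedStft l φ a).comp (by fun_prop : Continuous fun ξ => (x, ξ))) ?_⟩
  simp only [eLpNorm_exponent_top]
  filter_upwards [ae_le_eLpNormEssSup (μ := volume) (f := fun ξ =>
    eLpNormEssSup (fun x => stft φ a x ξ * (weight ω l x ξ : ℂ)) volume)] with ξ hξ
  refine forall_le_of_ae_le
    ((continuous_weightedStft l φ a).comp (by fun_prop : Continuous fun x => (x, ξ))) ?_ x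
  filter_upwards [ae_le_eLpNormEssSup (μ := volume)
    (f := fun x => stft φ a x ξ * (weight ω l x ξ : ℂ))] with z hz
  rw [enorm_stft_mul_weight] at hz
  exact hz.trans hξ

/-- Dominated convergence along a filter requires a countable basis. -/
instance isCountablyGenerated_cocompact : (cocompact (Euc d)).IsCountablyGenerated := by
  rw [← Metric.cobounded_eq_cocompact, ← comap_norm_atTop]; infer_instance

/-- Dominated convergence in the change-of-window integral: the translated transform is bounded by
N, the kernel is integrable, and the integrand tends to 0 at each p. Only the limit at each fixed
frequency is needed. -/
lemma tendsto_weightedStft {l : ℝ} (hl : 0 ≤ l) (a : Dist ω d) {γ : S ω d} (hγ : γ ≠ 0)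
    {N : ℝ≥0∞} (hN : N < ∞) (hb : ∀ x ξ, weightedStft l γ a x ξ ≤ N)
    (h0 : ∀ ξ, Tendsto (fun x => weightedStft l γ a x ξ) (cocompact (Euc d)) (𝓝 0))
    (ψ : S ω d) (ξ : Euc d) :
    Tendsto (fun x => weightedStft l ψ a x ξ) (cocompact (Euc d)) (𝓝 0) := by
  have h : Tendsto (fun x => ∫⁻ p : Euc d × Euc d,
      windowKernel l γ ψ p * weightedStft l γ a (x + p.1) (ξ + p.2)) (cocompact (Euc d))
      (𝓝 (∫⁻ _ : Euc d × Euc d, 0)) := by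
    refine tendsto_lintegral_filter_of_dominated_convergence
      (fun p => windowKernel l γ ψ p * N) (Eventually.of_forall fun x => ?_)
      (Eventually.of_forall fun x => Eventually.of_forall fun p => mul_le_mul_right (hb _ _) _) ?_
      (Eventually.of_forall fun p => ?_)
    · exact (measurable_windowKernel l γ ψ).mul ((continuous_weightedStft l γ a).comp
        (by fun_prop : Continuous fun p : Euc d × Euc d => (x + p.1, ξ + p.2))).measurable
    · rw [lintegral_mul_const _ (measurable_windowKernel l γ ψ)]
      exact (ENNReal.mul_lt_top (lintegral_windowKernel_lt_top hl γ ψ) hN).ne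
    · have ht : Tendsto (fun x => weightedStft l γ a (x + p.1) (ξ + p.2)) (cocompact (Euc d))
          (𝓝 0) :=
        (h0 (ξ + p.2)).comp (Homeomorph.addRight p.1).isClosedEmbedding.tendsto_cocompact
      have h := ENNReal.Tendsto.const_mul (a := windowKernel l γ ψ p) ht
        (Or.inr ENNReal.ofReal_ne_top)
      rwa [mul_zero] at h
  rw [lintegral_zero] at h
  have h' := ENNReal.Tendsto.const_mul h (Or.inr (ENNReal.ofReal_ne_top (r := (windowConst γ)⁻¹)))
  rw [mul_zero] at h'
  exact tendsto_of_tendsto_of_tendsto_of_le_of_le tendsto_const_nhds h' (fun _ => zero_le)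
    fun x => weightedStft_le_lintegral hl a hγ ψ x ξ

end WeightedTransform

/-! ### The convolution as a change of window, with decay in the frequency. -/

section Convolution

/-- The window `G_ξ` with `V_g(a * H)(x, ξ) = V_{G_ξ} a(x, ξ)`. -/
def convolutionWindow (H g : S ω d) (ξ : Euc d) : S ω d :=
  S.correlation (S.modulate ξ H.conj) g

lemma stft_convolution (a : Dist ω d) (H g : S ω d) (x ξ : Euc d) :
    stft g (convolution a H) x ξ = stft (convolutionWindow H g ξ) a x ξ := by
  refine congrArg a (S.ext (funext fun y => ?_))
  rw [conj_modulate_translate_val, S.conj_val]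
  change S.correlationFun H _ y = _ * starRingEnd ℂ (S.correlationFun _ g (y - x))
  rw [S.correlationFun_eq, S.correlationFun_eq, ← integral_conj, ← integral_const_mul]
  refine integral_congr_ae (Eventually.of_forall fun s => ?_)
  have hmod : starRingEnd ℂ ((S.modulate ξ H.conj).val s) =
      Complex.exp (-(Complex.I * ((inner ℝ s ξ : ℝ) : ℂ))) * H.val s := by
    simp [S.modulate, S.val_mk, S.conj_val, ← Complex.exp_conj]
  have hexp : Complex.exp (-(Complex.I * ((inner ℝ (y + s) ξ : ℝ) : ℂ))) =
      Complex.exp (-(Complex.I * ((inner ℝ y ξ : ℝ) : ℂ))) *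
        Complex.exp (-(Complex.I * ((inner ℝ s ξ : ℝ) : ℂ))) := by
    rw [← Complex.exp_add, inner_add_left]; congr 1; push_cast; ring
  simp only
  rw [conj_modulate_translate_val, map_mul, hmod, hexp, S.conj_val,
    show y + s - x = y - x + s by abel]
  ring

lemma norm_modulate_val (u : S ω d) (ξ y : Euc d) : ‖(S.modulate ξ u).val y‖ = ‖u.val y‖ := by
  rw [S.modulate, S.val_mk, norm_mul, Complex.norm_exp]; simp

lemma norm_fourier_convolutionWindow (H g : S ω d) (ξ η : Euc d) :
    ‖fourier (convolutionWindow H g ξ).val η‖ =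
      ‖fourier H.val (η + ξ)‖ * ‖fourier g.val η‖ := by
  have h : fourier (convolutionWindow H g ξ).val η =
      fourier (S.modulate ξ H.conj).val (-η) * fourier g.val η :=
    congrFun (S.fourier_correlationFun _ g) η
  have h2 : (S.modulate ξ H.conj).val = fun y =>
      Complex.exp (-(Complex.I * ((inner ℝ y (-ξ) : ℝ) : ℂ))) * H.conj.val y := by
    funext y; simp [S.modulate, S.val_mk]
  have h3 : H.conj.val = fun y => starRingEnd ℂ (H.val y) := rfl
  rw [h, norm_mul, h2, fourier_mul_char, h3, fourier_conj, RCLike.norm_conj]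
  congr 3
  abel

/-- Modulation leaves |H| unchanged, so the time bound of the window is uniform in ξ; its frequency
bound carries e^{-2mω(ξ)}, because η and η + ξ cannot both be small when ξ is large. The geometric
mean of the two keeps e^{-mω(ξ)}. -/
lemma exists_stftFun_convolutionWindow_le (γ H g : S ω d) {m : ℝ} (hm : 0 < m) :
    ∃ C, 0 ≤ C ∧ ∀ ξ t η, Real.exp (m * ω ‖t‖) * Real.exp (m * ω ‖η‖) *
      ‖stftFun γ (convolutionWindow H g ξ) t η‖ ≤ C * Real.exp (-(m * ω ‖ξ‖)) := by
  obtain ⟨C, hC, h⟩ := exists_stftFun_bound γ hm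
  obtain ⟨Cg, hCg, hg⟩ := g.exists_exp_weight_mul_le (l := 2 * m) (by positivity)
  -- Half of 4m supplies the weight at ζ; the other half pays for ω(ξ) ≤ ω(ζ + ξ) + ω(ζ).
  obtain ⟨Dg, hDg, hg'⟩ := g.fourierS.exists_exp_weight_mul_le (l := 4 * m) (by positivity)
  obtain ⟨DH, hDH, hH'⟩ := H.fourierS.exists_exp_weight_mul_le (l := 2 * m) (by positivity)
  set IH := ∫ s, Real.exp (2 * m * ω ‖s‖) * ‖H.val s‖ with hIH
  have hIH0 : 0 ≤ IH := integral_nonneg fun s => by positivity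
  refine ⟨Real.sqrt (C * (IH * Cg * (DH * Dg))), Real.sqrt_nonneg _, fun ξ t η => ?_⟩
  have hA : ∀ y, Real.exp (2 * m * ω ‖y‖) * ‖(convolutionWindow H g ξ).val y‖ ≤ IH * Cg :=
    fun y => by
    have := S.correlationFun_bound (S.modulate ξ H.conj) g (l := 2 * m) (by positivity) 0
      (C := Cg) (fun x => by simpa using hg x) y
    simp only [norm_iteratedFDeriv_zero, norm_modulate_val, S.norm_conj_val] at this
    exact this
  have hB : ∀ ζ, Real.exp (2 * m * ω ‖ζ‖) * ‖fourier (convolutionWindow H g ξ).val ζ‖ ≤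
      DH * Dg * Real.exp (-(m * ω ‖ξ‖)) ^ 2 := fun ζ => by
    rw [norm_fourier_convolutionWindow]
    have hsub : Real.exp (2 * m * ω ‖ξ‖) ≤
        Real.exp (2 * m * ω ‖ζ + ξ‖) * Real.exp (2 * m * ω ‖ζ‖) := by
      have := exp_weight_add_le (ω := ω) (l := 2 * m) (by positivity) (ζ + ξ) (-ζ)
      rwa [norm_neg, show ζ + ξ + -ζ = ξ by abel] at this
    have h4 : Real.exp (4 * m * ω ‖ζ‖) =
        Real.exp (2 * m * ω ‖ζ‖) * Real.exp (2 * m * ω ‖ζ‖) := by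
      rw [← Real.exp_add]; congr 1; ring
    have hξ : Real.exp (-(m * ω ‖ξ‖)) ^ 2 = (Real.exp (2 * m * ω ‖ξ‖))⁻¹ := by
      rw [← Real.exp_nat_mul, ← Real.exp_neg]; congr 1; push_cast; ring
    rw [hξ, ← div_eq_mul_inv, le_div_iff₀ (Real.exp_pos _)]
    calc _ ≤ Real.exp (2 * m * ω ‖ζ‖) * (‖fourier H.val (ζ + ξ)‖ * ‖fourier g.val ζ‖) *
          (Real.exp (2 * m * ω ‖ζ + ξ‖) * Real.exp (2 * m * ω ‖ζ‖)) := by gcongr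
      _ = (Real.exp (2 * m * ω ‖ζ + ξ‖) * ‖fourier H.val (ζ + ξ)‖) *
          (Real.exp (4 * m * ω ‖ζ‖) * ‖fourier g.val ζ‖) := by rw [h4]; ring
      _ ≤ DH * Dg := mul_le_mul (hH' _) (hg' _) (by positivity) hDH
  refine le_trans (Real.le_sqrt_of_sq_le (h _ _ _ hA hB t η)) (le_of_eq ?_)
  rw [← mul_assoc (IH * Cg), ← mul_assoc C, Real.sqrt_mul (by positivity),
    Real.sqrt_sq (Real.exp_pos _).le]

lemma exists_weightedStft_convolution_le {l : ℝ} (hl : 0 ≤ l) {a : Dist ω d} {φ : S ω d}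
    (hφ : φ ≠ 0) (ha : a ∈ modulationSpace l ∞ ∞ φ) (H g : S ω d) (k : ℝ) :
    ∃ C, C < ∞ ∧ ∀ x ξ, weightedStft l g (convolution a H) x ξ ≤
      C * ENNReal.ofReal (Real.exp (-(k * ω ‖ξ‖))) := by
  obtain ⟨N, hN, hb⟩ := exists_bound_weightedStft ha
  obtain ⟨m, hm, hi⟩ := integrable_exp_weight_prod (d := d) (ω := ω)
  -- At least k for the decay in ξ, and at least l + m so that an integrable factor e^{-mω} is left
  -- after the weight e^{lω} is spent.
  set n := max k (l + m) with hn
  have hn0 : 0 < n := lt_of_lt_of_le (by positivity) (le_max_right k (l + m))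
  obtain ⟨C, hC, hw⟩ := exists_stftFun_convolutionWindow_le φ H g hn0
  have hfin := (hi (n - l) (by linarith [le_max_right k (l + m)])).lintegral_lt_top
  set I := ∫⁻ p : Euc d × Euc d, ENNReal.ofReal
    (Real.exp (-((n - l) * ω ‖p.1‖)) * Real.exp (-((n - l) * ω ‖p.2‖))) with hI
  refine ⟨ENNReal.ofReal (windowConst φ)⁻¹ * (ENNReal.ofReal C * I * N),
    ENNReal.mul_lt_top ENNReal.ofReal_lt_top (ENNReal.mul_lt_top
      (ENNReal.mul_lt_top ENNReal.ofReal_lt_top hfin) hN), fun x ξ => ?_⟩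
  have heq : weightedStft l g (convolution a H) x ξ =
      weightedStft l (convolutionWindow H g ξ) a x ξ := by
    rw [weightedStft, weightedStft, stft_convolution]
  rw [heq]
  refine (weightedStft_le_of_bounded hl a hφ hb _ x ξ).trans ?_
  have hk : ∫⁻ p, windowKernel l φ (convolutionWindow H g ξ) p ≤
      ENNReal.ofReal C * ENNReal.ofReal (Real.exp (-(k * ω ‖ξ‖))) * I := by
    rw [← ENNReal.ofReal_mul hC, hI, ← lintegral_const_mul' _ _ ENNReal.ofReal_ne_top]
    refine lintegral_mono fun p => ?_
    rw [windowKernel, ← ENNReal.ofReal_mul (by positivity)]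
    refine ENNReal.ofReal_le_ofReal ?_
    calc _ = (Real.exp (n * ω ‖p.1‖) * Real.exp (n * ω ‖p.2‖) *
          ‖stftFun φ (convolutionWindow H g ξ) p.1 p.2‖) *
          (Real.exp (-((n - l) * ω ‖p.1‖)) * Real.exp (-((n - l) * ω ‖p.2‖))) := by
          have : ∀ y : Euc d, Real.exp (l * ω ‖y‖) =
              Real.exp (n * ω ‖y‖) * Real.exp (-((n - l) * ω ‖y‖)) := fun y => by
            rw [← Real.exp_add]; congr 1; ring
          rw [this, this]; ring
      _ ≤ _ := by
          refine mul_le_mul_of_nonneg_right ((hw ξ p.1 p.2).trans ?_) (by positivity)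
          refine mul_le_mul_of_nonneg_left (Real.exp_le_exp.2 (neg_le_neg ?_)) hC
          exact mul_le_mul_of_nonneg_right (le_max_left _ _) (weight_nonneg ξ)
  calc _ ≤ ENNReal.ofReal (windowConst φ)⁻¹ *
        (ENNReal.ofReal C * ENNReal.ofReal (Real.exp (-(k * ω ‖ξ‖))) * I * N) := by gcongr
    _ = _ := by ring

end Convolution

/-! ### Membership in M^{∞,1} and vanishing at infinity. -/

section MainResult

lemma convolution_mem_modulationSpace {l : ℝ} (hl : 0 ≤ l) {a : Dist ω d} {φ : S ω d}
    (hφ : φ ≠ 0) (ha : a ∈ modulationSpace l ∞ ∞ φ) (H g : S ω d) :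
    OmegaTempered.convolution a H ∈ modulationSpace l ∞ 1 g := by
  obtain ⟨m, hm, hi⟩ := exists_integrable_exp_weight (d := d) (ω := ω)
  obtain ⟨C, hC, hb⟩ := exists_weightedStft_convolution_le hl hφ ha H g m
  refine ⟨(continuous_stft g _).aestronglyMeasurable, ?_⟩
  rw [eLpNorm_one_eq_lintegral_enorm]
  refine lt_of_le_of_lt (lintegral_mono fun ξ => ?_)
    (b := ∫⁻ ξ : Euc d, C * ENNReal.ofReal (Real.exp (-(m * ω ‖ξ‖)))) ?_
  · rw [enorm_eq_self, eLpNorm_exponent_top]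
    refine essSup_le_of_ae_le _ (Eventually.of_forall fun x => ?_)
    exact (enorm_stft_mul_weight l g _ x ξ).trans_le (hb x ξ)
  · rw [lintegral_const_mul' _ _ hC.ne]
    exact ENNReal.mul_lt_top hC (hi m le_rfl).lintegral_lt_top

lemma tendsto_lintegral_stft_convolution {l : ℝ} (hl : 0 ≤ l) {a : Dist ω d} {φ g₀ : S ω d}
    (hφ : φ ≠ 0) (ha : a ∈ modulationSpace l ∞ ∞ φ) (hg₀ : g₀ ≠ 0)
    (h0 : ∀ ξ, Tendsto (fun x => weightedStft l g₀ a x ξ) (cocompact (Euc d)) (𝓝 0))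
    (H g : S ω d) :
    Tendsto (fun x => (∫⁻ ξ, ‖stft g (OmegaTempered.convolution a H) x ξ‖ₑ *
      ENNReal.ofReal (weightOne ω l ξ)) * ENNReal.ofReal (weightOne ω l x))
      (cocompact (Euc d)) (𝓝 0) := by
  obtain ⟨m, hm, hi⟩ := exists_integrable_exp_weight (d := d) (ω := ω)
  -- The part l of the decay cancels e^{lω(ξ)} in the limit condition; the part m makes the majorant
  -- integrable.
  obtain ⟨C, hC, hb⟩ := exists_weightedStft_convolution_le hl hφ ha H g (l + m)
  obtain ⟨N, hN, hφb⟩ := exists_bound_weightedStft ha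
  -- The limit hypothesis concerns g₀ but boundedness is known for φ; a first change of window moves
  -- the bound to g₀, where it serves as the majorant.
  have hN' : ENNReal.ofReal (windowConst φ)⁻¹ * ((∫⁻ p, windowKernel l φ g₀ p) * N) < ∞ :=
    ENNReal.mul_lt_top ENNReal.ofReal_lt_top
      (ENNReal.mul_lt_top (lintegral_windowKernel_lt_top hl φ g₀) hN)
  have hpt := tendsto_weightedStft hl a hg₀ hN' (weightedStft_le_of_bounded hl a hφ hφb g₀) h0
  let F : Euc d → Euc d → ℝ≥0∞ := fun x ξ =>
    ENNReal.ofReal (weightOne ω l ξ) * weightedStft l g (OmegaTempered.convolution a H) x ξ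
  -- The separate factor e^{lω(x)} is absorbed by the joint weight, since |x| ≤ |(x, ξ)|.
  have hle : ∀ x, (∫⁻ ξ, ‖stft g (OmegaTempered.convolution a H) x ξ‖ₑ *
      ENNReal.ofReal (weightOne ω l ξ)) * ENNReal.ofReal (weightOne ω l x) ≤ ∫⁻ ξ, F x ξ :=
    fun x => by
    rw [← lintegral_mul_const' _ _ ENNReal.ofReal_ne_top]
    refine lintegral_mono fun ξ => ?_
    simp only [F]
    rw [weightedStft, mul_comm ‖stft g (OmegaTempered.convolution a H) x ξ‖ₑ, mul_assoc]
    gcongr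
    exact weightOne_le_weight hl x ξ
  have hF : Tendsto (fun x => ∫⁻ ξ, F x ξ) (cocompact (Euc d)) (𝓝 (∫⁻ _ : Euc d, 0)) := by
    refine tendsto_lintegral_filter_of_dominated_convergence
      (fun ξ => C * ENNReal.ofReal (Real.exp (-(m * ω ‖ξ‖)))) (Eventually.of_forall fun x => ?_)
      (Eventually.of_forall fun x => Eventually.of_forall fun ξ => ?_) ?_
      (Eventually.of_forall fun ξ => ?_)
    · exact (continuous_exp_weight l).measurable.ennreal_ofReal.mul
        ((continuous_weightedStft l g _).comp
          (by fun_prop : Continuous fun ξ : Euc d => (x, ξ))).measurable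
    · refine (mul_le_mul_right (hb x ξ) _).trans_eq ?_
      rw [mul_left_comm, weightOne, ← ENNReal.ofReal_mul (Real.exp_pos _).le, ← Real.exp_add]
      congr 3; ring
    · rw [lintegral_const_mul' _ _ hC.ne]
      exact (ENNReal.mul_lt_top hC (hi m le_rfl).lintegral_lt_top).ne
    -- With ξ fixed the window G_ξ is a single test function, so the qualitative limit for arbitrary
    -- windows applies.
    · have h := ENNReal.Tendsto.const_mul (hpt (convolutionWindow H g ξ) ξ)
        (Or.inr (ENNReal.ofReal_ne_top (r := weightOne ω l ξ)))
      rw [mul_zero] at h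
      refine h.congr fun x => ?_
      simp only [F, weightedStft, stft_convolution]
  rw [lintegral_zero] at hF
  exact tendsto_of_tendsto_of_tendsto_of_le_of_le tendsto_const_nhds hF (fun _ => zero_le) hle

end MainResult

end OmegaTempered

end

open OmegaTempered in
theorem mainTheorem5 (d : ℕ) (ω : OmegaTempered.WeightFunction) (l : ℝ) (hl : 0 ≤ l)
    (g₀ : OmegaTempered.S ω d) (hg₀ : g₀ ≠ 0)
    (a : OmegaTempered.Dist ω d)
    (φ : OmegaTempered.S ω d) (hφ : φ ≠ 0)
    (ha : a ∈ OmegaTempered.modulationSpace l ∞ ∞ φ)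
    (hlim : ∀ R : ℝ, 0 < R →
      Tendsto (fun x => ⨆ ξ ∈ Metric.closedBall (0 : OmegaTempered.Euc d) R,
        ‖OmegaTempered.stft g₀ a x ξ‖ₑ * ENNReal.ofReal (OmegaTempered.weight ω l x ξ))
        (cocompact (OmegaTempered.Euc d)) (𝓝 0))
    (H : OmegaTempered.S ω d) (g : OmegaTempered.S ω d) (hg : g ≠ 0) :
    OmegaTempered.convolution a H ∈ OmegaTempered.modulationSpaceZeroOne l g := by
  refine ⟨convolution_mem_modulationSpace hl hφ ha H g,
    tendsto_lintegral_stft_convolution hl hφ ha hg₀ (fun ξ => ?_) H g⟩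
  -- Any ball containing ξ would do; the radius ‖ξ‖ + 1 stays positive at ξ = 0.
  refine tendsto_of_tendsto_of_tendsto_of_le_of_le tendsto_const_nhds
    (hlim (‖ξ‖ + 1) (by positivity)) (fun _ => zero_le) fun x => ?_
  exact le_iSup₂ (f := fun ζ (_ : ζ ∈ Metric.closedBall (0 : Euc d) (‖ξ‖ + 1)) =>
    ‖stft g₀ a x ζ‖ₑ * ENNReal.ofReal (weight ω l x ζ)) ξ (by simp)
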